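/- Let $m,n\ge 2$ and let $N$ be a connected smooth $n$-dimensional manifold without boundary (Hausdorff, with countable basis). A pair of continuous maps $f_1,f_2\colon S^m\to N$ is called loose if there are continuous maps $f_1',f_2'\colon S^m\to N$ with $f_i'$ (freely) homotopic to $f_i$ for $i=1,2$ and $f_1'(x)\neq f_2'(x)$ for all $x\in S^m$. Every pair of continuous maps $f_1,f_2\colon S^m\to N$ is loose if at least one of the following conditions holds: (i) $m<n$; (ii) $N$ is not compact; (iii) the fundamental group $\pi_1(N)$ is infinite; (iv) $N$ is the total space of a Serre fibration with a section and with fiber and base of strictly positive dimension; that is, there are a topological space $B$ and a continuous map $p\colon N\to B$ which has the homotopy lifting property for all cubes $[0,1]^k$ ($k\ge 0$) and admits a continuous map $s\colon B\to N$ with $p\circ s=\mathrm{id}_B$, such that $B$ and some fiber $p^{-1}(\{b\})$, $b\in B$, have strictly positive (small inductive) dimension. (For base and fiber that are topological manifolds, this is the usual dimension.) -/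

import Mathlib

open scoped Manifold ContDiff unitInterval

section Coincidences

variable {X Y : Type*} [TopologicalSpace X] [TopologicalSpace Y]

/-- The coincidence locus of two maps. -/
def coincidenceLocus (f₁ f₂ : C(X, Y)) : Set X :=
  {x | f₁ x = f₂ x}

/-- The pair `(f₁, f₂)` is loose: `f₁` and `f₂` are (freely) homotopic to maps without
coincidences. -/
def IsLoosePair (f₁ f₂ : C(X, Y)) : Prop :=
  ∃ g₁ g₂ : C(X, Y), f₁.Homotopic g₁ ∧ f₂.Homotopic g₂ ∧ coincidenceLocus g₁ g₂ = ∅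

end Coincidences

/-- A Serre fibration: a continuous map with the homotopy lifting property for all cubes
`[0,1]^k`, `k ≥ 0`. -/
def IsSerreFibration {E B : Type*} [TopologicalSpace E] [TopologicalSpace B]
    (p : C(E, B)) : Prop :=
  ∀ (k : ℕ) (H : C((Fin k → I) × I, B)) (g : C(Fin k → I, E)),
    (∀ x, p (g x) = H (x, 0)) →
      ∃ G : C((Fin k → I) × I, E), (∀ x, G (x, 0) = g x) ∧ ∀ z, p (G z) = H z

/-! The proof isolates a condition on a single map. Call `f` avoidable at a pole `e` (`Avoidable`)
if, after a homotopy, `f x` never equals `δ (ht e x)` for some curve `δ` in `N`. If `f₁` is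
avoidable at `e` and `f₂` at `-e`, the pair is loose (`isLoosePair_of_avoidable`): squeeze `f₁` into
the cap around `e` and `f₂` into the cap around `-e`. On each cap the other map is free to run along
the curve that is avoided there. On the band in between both maps depend on the height only, and
they follow two paths that differ at every time. Such paths exist because `N` has dimension at least
two, so that point complements are path connected (`exists_paths_ne`).

It remains to see that every map is avoidable. A map homotopic to a non-surjective one is avoidable,
with `δ` constant. If `m < n`, smooth approximation inside a chart and a Hausdorff dimension count
give this (`exists_homotopic_notMem_of_lt`). If `N` is noncompact, the compact image already misses
a point. If `π₁(N)` is infinite, lift to the universal cover, where the fibre over a point is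
infinite, closed and discrete, so that the cover is noconpact-free of no compactness: the lift can
be pushed off that fibre by isotopy-like moves (`exists_homotopic_notMem_of_infinite`).

For a fibration with section, deform `f` so that the upper hemisphere lies in one fibre, the lower
one in the image of the section and a band around the equator goes to one point `s b₀`. A path from
a point off the section to a point off that fibre, avoiding `s b₀`, is then the curve `δ`
(`avoidable_of_serreFibration`). -/

/-! ### Axially symmetric deformations of the sphere -/

noncomputable section SphereMaps

open Metric

variable {V : Type*} [NormedAddCommGroup V] [InnerProductSpace ℝ V]

/-- The height of a vector in the direction `e`. -/
def height (e x : V) : ℝ := inner ℝ x e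

lemma continuous_height (e : V) : Continuous (height e) := by
  unfold height; fun_prop

lemma height_neg_left (e x : V) : height (-e) x = - height e x := by simp [height]

lemma height_neg_right (e x : V) : height e (-x) = - height e x := by simp [height]

/-- The vector with horizontal part `β` times that of `x` and height `α`. -/
def axial (e : V) (α β : ℝ) (x : V) : V := β • (x - height e x • e) + α • e

lemma height_self {e : V} (he : ‖e‖ = 1) : height e e = 1 := by
  simp [height, he]

lemma axial_self {e : V} (x : V) : axial e (height e x) 1 x = x := by
  simp [axial]

lemma axial_neg (e : V) (α β : ℝ) (x : V) : axial (-e) α β x = axial e (-α) β x := by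
  simp [axial, height_neg_left]

lemma height_axial {e : V} (he : ‖e‖ = 1) (α β : ℝ) (x : V) : height e (axial e α β x) = α := by
  simp [height, axial, inner_add_left, inner_smul_left, inner_sub_left, he]

lemma norm_sq_axial {e : V} (he : ‖e‖ = 1) (α β : ℝ) {x : V} (hx : ‖x‖ = 1) :
    ‖axial e α β x‖ ^ 2 = β ^ 2 * (1 - height e x ^ 2) + α ^ 2 := by
  have h1 : inner ℝ (x - height e x • e) e = 0 := by
    simp [height, inner_sub_left, inner_smul_left, he]
  have h2 : ‖x - height e x • e‖ ^ 2 = 1 - height e x ^ 2 := by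
    rw [norm_sub_sq_real, norm_smul, hx, he, inner_smul_right]
    simp only [height, Real.norm_eq_abs, mul_one, sq_abs]; ring
  rw [axial, norm_add_sq_real, inner_smul_left, inner_smul_right, h1, norm_smul, norm_smul, mul_pow,
    mul_pow, h2, he]
  simp

lemma abs_height_le {e x : V} (he : ‖e‖ = 1) (hx : ‖x‖ = 1) : |height e x| ≤ 1 := by
  have := abs_real_inner_le_norm x e
  rwa [he, hx, mul_one] at this

/-- The height of a point of the unit sphere in the direction of another one. -/
abbrev ht (e x : sphere (0 : V) 1) : ℝ := height (e : V) x

lemma ht_self (e : sphere (0 : V) 1) : ht e e = 1 := height_self (norm_eq_of_mem_sphere e)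

lemma ht_neg_left (e x : sphere (0 : V) 1) : ht (-e) x = - ht e x := height_neg_left _ _

lemma ht_neg_right (e x : sphere (0 : V) 1) : ht e (-x) = - ht e x := height_neg_right _ _

lemma continuous_ht (e : sphere (0 : V) 1) : Continuous (ht e) :=
  (continuous_height _).comp continuous_subtype_val

lemma ht_mem (e x : sphere (0 : V) 1) : ht e x ∈ Set.Icc (-1 : ℝ) 1 :=
  abs_le.mp (abs_height_le (norm_eq_of_mem_sphere e) (norm_eq_of_mem_sphere x))

/-- Continuous data for a one-parameter family of axially symmetric self-maps of a sphere. -/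
structure AxialFamily where
  α : ℝ → ℝ → ℝ
  β : ℝ → ℝ → ℝ
  cα : Continuous fun z : ℝ × ℝ ↦ α z.1 z.2
  cβ : Continuous fun z : ℝ × ℝ ↦ β z.1 z.2
  -- By `norm_sq_axial` this is the squared norm of the axial vector over a unit vector of height
  -- `a`, so the family can be normalized.
  pos : ∀ t ∈ Set.Icc (0 : ℝ) 1, ∀ a ∈ Set.Icc (-1 : ℝ) 1, 0 < β t a ^ 2 * (1 - a ^ 2) + α t a ^ 2

namespace AxialFamily

variable (Φ : AxialFamily)

/-- The non-normalized family. -/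
def vec (e : V) (t : ℝ) (x : V) : V := axial e (Φ.α t (height e x)) (Φ.β t (height e x)) x

lemma vec_ne (e : sphere (0 : V) 1) (t : I) (x : sphere (0 : V) 1) : Φ.vec (e : V) t x ≠ 0 := by
  have he := norm_eq_of_mem_sphere e
  have hx := norm_eq_of_mem_sphere x
  have := Φ.pos t t.2 _ (abs_le.mp (abs_height_le he hx))
  rw [← norm_sq_axial he _ _ hx] at this
  intro h
  rw [vec] at h
  rw [h] at this
  simp at this

/-- The family of self-maps of the sphere. -/
def map (e : sphere (0 : V) 1) : C(I × sphere (0 : V) 1, sphere (0 : V) 1) where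
  toFun z := ⟨‖Φ.vec (e : V) z.1 z.2‖⁻¹ • Φ.vec (e : V) z.1 z.2, by
    have := Φ.vec_ne e z.1 z.2
    simp [norm_smul, this]⟩
  continuous_toFun := by
    have hc : Continuous fun z : I × sphere (0 : V) 1 ↦ Φ.vec (e : V) z.1 z.2 := by
      have h : Continuous fun z : I × sphere (0 : V) 1 ↦ height (e : V) z.2 :=
        (continuous_height _).comp (by fun_prop)
      have h1 : Continuous fun z : I × sphere (0 : V) 1 ↦ ((z.1 : ℝ), height (e : V) z.2) := by
        fun_prop
      have h2 := Φ.cα.comp h1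
      have h3 := Φ.cβ.comp h1
      simp only [Function.comp_def] at h2 h3
      unfold vec axial
      fun_prop
    refine Continuous.subtype_mk (Continuous.smul (hc.norm.inv₀ fun z ↦ ?_) hc) _
    simpa using Φ.vec_ne e z.1 z.2

lemma coe_map (e : sphere (0 : V) 1) (t : I) (x : sphere (0 : V) 1) :
    (Φ.map e (t, x) : V) = ‖Φ.vec (e : V) t x‖⁻¹ • Φ.vec (e : V) t x := rfl

lemma height_map (e : sphere (0 : V) 1) (t : I) (x : sphere (0 : V) 1) :
    height (e : V) (Φ.map e (t, x)) = ‖Φ.vec (e : V) t x‖⁻¹ * Φ.α t (ht e x) := by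
  have he := norm_eq_of_mem_sphere e
  rw [coe_map, ← height_axial he (Φ.α t (height (e : V) x)) (Φ.β t (height (e : V) x)) x]
  simp [height, inner_smul_left, vec]

lemma inv_norm_vec_pos (e : sphere (0 : V) 1) (t : I) (x : sphere (0 : V) 1) :
    0 < ‖Φ.vec (e : V) t x‖⁻¹ := by
  have := Φ.vec_ne e t x
  positivity

lemma map_eq_self {e : sphere (0 : V) 1} {t : I} {x : sphere (0 : V) 1}
    (hα : Φ.α t (ht e x) = ht e x) (hβ : Φ.β t (ht e x) = 1) :
    Φ.map e (t, x) = x := by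
  ext1
  rw [coe_map, vec, hα, hβ, axial_self]
  simp

lemma map_eq_bot {e : sphere (0 : V) 1} {t : I} {x : sphere (0 : V) 1}
    (hα : Φ.α t (ht e x) < 0) (hβ : Φ.β t (ht e x) = 0) :
    Φ.map e (t, x) = -e := by
  ext1
  rw [coe_map, vec, hβ, axial]
  have : |Φ.α t (ht e x)|⁻¹ * Φ.α t (ht e x) = -1 := by
    rw [abs_of_neg hα]; field_simp [hα.ne]
  simp [norm_smul, smul_smul, this]

end AxialFamily

/-- Collapses the closed lower hemisphere to the south pole. -/
def collapseFamily : AxialFamily where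
  α t a := a - t * (1 - a)
  β t a := (1 - t) + t * max a 0
  cα := by fun_prop
  cβ := by fun_prop
  pos := by
    rintro t ⟨ht0, ht1⟩ a ⟨ha0, ha1⟩
    by_contra! h
    have h1 : 0 ≤ 1 - a ^ 2 := by nlinarith
    have h2 : 0 ≤ ((1 - t) + t * max a 0) ^ 2 * (1 - a ^ 2) := by positivity
    have h3 : (a - t * (1 - a)) ^ 2 = 0 := le_antisymm (by linarith) (by positivity)
    have h3' : a - t * (1 - a) = 0 := by simpa using h3
    have ha : 0 ≤ a := by nlinarith
    have h4 : ((1 - t) + t * max a 0) ^ 2 * (1 - a ^ 2) = 0 := by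
      apply le_antisymm _ h2; linarith
    rcases mul_eq_zero.mp h4 with h5 | h5
    · have h5 : (1 - t) + t * max a 0 = 0 := by simpa using h5
      rw [max_eq_left ha] at h5
      have h6 : t = 1 := by nlinarith [mul_nonneg ht0 ha]
      subst h6
      linarith
    · have : a = 1 := by nlinarith
      subst this
      linarith

/-- Collapses the band of heights `[-1/2, 1/2]` to the equator. -/
def collarFamily : AxialFamily where
  α t a := a - t * max (-(1 / 2)) (min a (1 / 2))
  β _ _ := 1
  cα := by fun_prop
  cβ := by fun_prop
  pos := by
    rintro t ⟨ht0, ht1⟩ a ⟨ha0, ha1⟩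
    by_contra! h
    have h1 : 0 ≤ 1 - a ^ 2 := by nlinarith
    have h2 : (a - t * max (-(1 / 2)) (min a (1 / 2))) ^ 2 = 0 := by
      apply le_antisymm _ (by positivity); linarith
    have h2' : a - t * max (-(1 / 2)) (min a (1 / 2)) = 0 := by simpa using h2
    have h3 : a ^ 2 = 1 := by nlinarith [sq_nonneg (a - t * max (-(1 / 2)) (min a (1 / 2)))]
    rcases (show a = 1 ∨ a = -1 by simpa using h3) with h4 | h4
    · subst h4; norm_num at h2'; linarith
    · subst h4; norm_num at h2'; linarith

/-- The deformation collapsing the closed lower hemisphere to `-e`. -/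
abbrev collapse (e : sphere (0 : V) 1) : C(I × sphere (0 : V) 1, sphere (0 : V) 1) :=
  collapseFamily.map e

/-- The deformation collapsing the band of heights `[-1/2, 1/2]` to the equator. -/
abbrev collar (e : sphere (0 : V) 1) : C(I × sphere (0 : V) 1, sphere (0 : V) 1) :=
  collarFamily.map e

lemma AxialFamily.map_pole (Φ : AxialFamily) {e : sphere (0 : V) 1} {t : I}
    (h : 0 < Φ.α t 1) : Φ.map e (t, e) = e := by
  ext1
  have h1 : height (e : V) e = 1 := ht_self e
  simp [coe_map, vec, axial, h1, norm_smul, abs_of_pos h, smul_smul, h.ne']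

variable (e x : sphere (0 : V) 1)

lemma collapse_zero : collapse e (0, x) = x :=
  collapseFamily.map_eq_self (by simp [collapseFamily]) (by simp [collapseFamily])

lemma collar_zero : collar e (0, x) = x :=
  collarFamily.map_eq_self (by simp [collarFamily]) (by simp [collarFamily])

variable {e x}

lemma collapse_one_of_nonpos (h : ht e x ≤ 0) : collapse e (1, x) = -e :=
  collapseFamily.map_eq_bot (by simp [collapseFamily]; linarith) (by simp [collapseFamily, h])

lemma collapse_neg_one_of_nonneg (h : 0 ≤ ht e x) : collapse (-e) (1, x) = e := by
  rw [collapse_one_of_nonpos (by rw [ht_neg_left]; linarith), neg_neg]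

lemma collar_neg (t : I) : collar (-e) (t, x) = collar e (t, x) := by
  have : collarFamily.vec ((-e : sphere (0 : V) 1) : V) t x = collarFamily.vec (e : V) t x := by
    have h : height ((-e : sphere (0 : V) 1) : V) x = - ht e x := ht_neg_left e x
    simp only [AxialFamily.vec, h]
    rw [show ((-e : sphere (0 : V) 1) : V) = -(e : V) from rfl, axial_neg]
    congr 1
    simp only [collarFamily]
    have : max (-(1 / 2)) (min (-ht e x) (1 / 2)) = - max (-(1 / 2)) (min (ht e x) (1 / 2)) := by
      rw [← min_neg_neg, ← max_neg_neg, neg_neg, max_min_distrib_left,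
        min_comm, max_comm (-ht e x)]
      norm_num
    rw [this]; ring
  ext1
  rw [AxialFamily.coe_map, AxialFamily.coe_map, this]

lemma ht_collar_nonneg (h : 0 ≤ ht e x) : 0 ≤ ht e (collar e (1, x)) := by
  have h1 := collarFamily.height_map e 1 x
  have h2 := collarFamily.inv_norm_vec_pos e 1 x
  change 0 ≤ height _ _
  rw [h1]
  refine mul_nonneg h2.le ?_
  simp only [collarFamily]
  have : max (-(1 / 2)) (min (ht e x) (1 / 2)) ≤ ht e x := max_le (by linarith) (min_le_left _ _)
  simpa using this

lemma ht_collar_nonpos (h : ht e x ≤ 0) : ht e (collar e (1, x)) ≤ 0 := by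
  have := ht_collar_nonneg (e := -e) (x := x) (by rw [ht_neg_left]; linarith)
  rw [collar_neg, ht_neg_left] at this
  linarith

lemma ht_collar_eq_zero (h : |ht e x| ≤ 1 / 2) : ht e (collar e (1, x)) = 0 := by
  have h1 := collarFamily.height_map e 1 x
  obtain ⟨h2, h3⟩ := abs_le.mp h
  change height _ _ = 0
  have h0 : collarFamily.α (1 : I) (ht e x) = 0 := by
    simp only [collarFamily]
    rw [min_eq_left h3, max_eq_right h2]
    simp
  rw [h1, h0, mul_zero]

end SphereMaps

/-! ### Looseness from avoidability -/

noncomputable section Join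

open Metric

variable {V : Type*} [NormedAddCommGroup V] [InnerProductSpace ℝ V]
variable {X : Type*} [TopologicalSpace X]

/-- Collapses everything below height `1/2`. -/
def capMap (e : sphere (0 : V) 1) : C(sphere (0 : V) 1, sphere (0 : V) 1) where
  toFun x := collapse e (1, collar e (1, x))

lemma capMap_of_le {e x : sphere (0 : V) 1} (h : ht e x ≤ 1 / 2) : capMap e x = -e := by
  apply collapse_one_of_nonpos
  rcases le_total (ht e x) 0 with h' | h'
  · exact ht_collar_nonpos h'
  · exact (ht_collar_eq_zero (by rw [abs_of_nonneg h']; exact h)).le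

lemma capMap_pole (e : sphere (0 : V) 1) : capMap e e = e := by
  change collapse e (1, collar e (1, e)) = e
  rw [collarFamily.map_pole (by norm_num [collarFamily]),
    collapseFamily.map_pole (by norm_num [collapseFamily])]

lemma homotopic_comp_collapse (e : sphere (0 : V) 1) (f : C(sphere (0 : V) 1, X)) :
    f.Homotopic (f.comp ((collapse e).curry 1)) :=
  ⟨{ toContinuousMap := f.comp (collapse e)
     map_zero_left := fun x ↦ by simp [collapse_zero]
     map_one_left := fun x ↦ rfl }⟩

lemma homotopic_comp_collar (e : sphere (0 : V) 1) (f : C(sphere (0 : V) 1, X)) :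
    f.Homotopic (f.comp ((collar e).curry 1)) :=
  ⟨{ toContinuousMap := f.comp (collar e)
     map_zero_left := fun x ↦ by simp [collar_zero]
     map_one_left := fun x ↦ rfl }⟩

lemma homotopic_comp_capMap (e : sphere (0 : V) 1) (f : C(sphere (0 : V) 1, X)) :
    f.Homotopic (f.comp (capMap e)) :=
  (homotopic_comp_collapse e f).trans (homotopic_comp_collar e (f.comp ((collapse e).curry 1)))

/-- The parameter along the tail attached to the cap `{1/2 ≤ ht e}`. -/
def tailParam (e x : sphere (0 : V) 1) : ℝ :=
  -- The first term grows from 0 to 1 across the band of heights from 1/2 down to -1/2. The second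
  -- vanishes there and ranges over [0, 2] on the opposite cap, whence the shift by 2 in
  -- `glueCurve`.
  max 0 (min (1 / 2 - ht e x) 1) + (1 - ht e (capMap (-e) x))

lemma continuous_tailParam (e : sphere (0 : V) 1) : Continuous (tailParam e) := by
  have h1 := continuous_ht e
  have h2 := h1.comp (capMap (-e)).continuous
  simp only [Function.comp_def] at h2
  unfold tailParam
  fun_prop

lemma capMap_neg_of_ge {e x : sphere (0 : V) 1} (h : - (1 / 2) ≤ ht e x) : capMap (-e) x = e := by
  rw [capMap_of_le (by rw [ht_neg_left]; linarith), neg_neg]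

lemma tailParam_of_ge {e x : sphere (0 : V) 1} (h : 1 / 2 ≤ ht e x) : tailParam e x = 0 := by
  rw [tailParam, capMap_neg_of_ge (by linarith), ht_self, min_eq_left (by linarith),
    max_eq_left (by linarith)]
  norm_num

lemma tailParam_of_abs_le {e x : sphere (0 : V) 1} (h : |ht e x| ≤ 1 / 2) :
    tailParam e x = 1 / 2 - ht e x := by
  obtain ⟨h1, h2⟩ := abs_le.mp h
  rw [tailParam, capMap_neg_of_ge (by linarith), ht_self, min_eq_left (by linarith),
    max_eq_right (by linarith)]
  norm_num

lemma tailParam_of_le {e x : sphere (0 : V) 1} (h : ht e x ≤ -(1 / 2)) :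
    tailParam e x = 2 + ht (-e) (capMap (-e) x) := by
  rw [tailParam, min_eq_right (by linarith), max_eq_right (by linarith), ht_neg_left]
  ring

lemma tailParam_antipole (e : sphere (0 : V) 1) : tailParam e (-e) = 3 := by
  rw [tailParam_of_le (by rw [ht_neg_right, ht_self]; norm_num), capMap_pole, ht_self]
  norm_num

/-- The map which is `f` on the cap `{1/2 ≤ ht e}` and runs along the curve `η` below it. -/
def withTail (e : sphere (0 : V) 1) (f : C(sphere (0 : V) 1, X)) (η : C(ℝ, X))
    (h : η 0 = f (-e)) : C(sphere (0 : V) 1, X) where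
  toFun x := if ht e x ≤ 1 / 2 then η (tailParam e x) else f (capMap e x)
  continuous_toFun := by
    refine Continuous.if_le (η.continuous.comp (continuous_tailParam e)) (by fun_prop)
      (continuous_ht e) continuous_const fun x hx ↦ ?_
    rw [tailParam_of_ge hx.ge, capMap_of_le hx.le, h]

variable {e x : sphere (0 : V) 1} {f : C(sphere (0 : V) 1, X)} {η : C(ℝ, X)} {h : η 0 = f (-e)}

lemma withTail_of_le (hx : ht e x ≤ 1 / 2) : withTail e f η h x = η (tailParam e x) :=
  if_pos hx

lemma withTail_of_ge (hx : 1 / 2 ≤ ht e x) : withTail e f η h x = f (capMap e x) := by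
  rcases hx.lt_or_eq with h' | h'
  · exact if_neg (not_le.mpr h')
  · rw [withTail_of_le h'.ge, tailParam_of_ge h'.le, capMap_of_le h'.ge, h]

lemma withTail_antipole : withTail e f η h (-e) = η 3 := by
  rw [withTail_of_le (by rw [ht_neg_right, ht_self]; norm_num), tailParam_antipole]

/-- Multiplying the tail parameter by the time retracts the tail to its origin `f (-e)`, which
leaves `f ∘ capMap e`. -/
lemma homotopic_withTail : f.Homotopic (withTail e f η h) := by
  refine (homotopic_comp_capMap e f).trans ⟨
    { toFun z := if ht e z.2 ≤ 1 / 2 then η (z.1 * tailParam e z.2) else f (capMap e z.2)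
      continuous_toFun := ?_
      map_zero_left := fun x ↦ ?_
      map_one_left := fun x ↦ ?_ }⟩
  · have h1 : Continuous fun z : I × sphere (0 : V) 1 ↦ tailParam e z.2 :=
      (continuous_tailParam e).comp continuous_snd
    refine Continuous.if_le (by fun_prop) (by fun_prop)
      ((continuous_ht e).comp continuous_snd) continuous_const fun z hz ↦ ?_
    rw [tailParam_of_ge hz.ge, capMap_of_le hz.le, mul_zero, h]
  · simp only [Set.Icc.coe_zero, zero_mul, h, ContinuousMap.comp_apply]
    split_ifs with hx
    · rw [capMap_of_le hx]
    · rfl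
  · simp only [Set.Icc.coe_one, one_mul]; rfl

/-- The curve running along `γ` on `[0, 1]` and along `δ` (shifted by `2`) on `[1, ∞)`. -/
def glueCurve {a b : X} (γ : Path a b) (δ : C(ℝ, X)) (h : b = δ (-1)) : C(ℝ, X) where
  toFun r := if r ≤ 1 then γ.extend r else δ (r - 2)
  continuous_toFun := by
    refine Continuous.if_le γ.continuous_extend (by fun_prop) continuous_id continuous_const ?_
    rintro r rfl
    rw [γ.extend_one, h]; norm_num

lemma glueCurve_of_mem {a b : X} {γ : Path a b} {δ : C(ℝ, X)} {h : b = δ (-1)} {r : ℝ}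
    (hr : r ∈ Set.Icc (0 : ℝ) 1) : glueCurve γ δ h r = γ ⟨r, hr⟩ :=
  (if_pos hr.2).trans (γ.extend_apply hr)

lemma glueCurve_of_ge {a b : X} {γ : Path a b} {δ : C(ℝ, X)} {h : b = δ (-1)} {r : ℝ}
    (hr : 1 ≤ r) : glueCurve γ δ h r = δ (r - 2) := by
  rcases hr.lt_or_eq with h' | rfl
  · exact if_neg (not_le.mpr h')
  · rw [glueCurve_of_mem (by simp)]
    refine (γ.target).trans (h.trans ?_); norm_num

/-- `f` is homotopic to a map without coincidences with some map that only depends on the height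
in the direction `e`. -/
def Avoidable (e : sphere (0 : V) 1) (f : C(sphere (0 : V) 1, X)) : Prop :=
  ∃ f' : C(sphere (0 : V) 1, X), f.Homotopic f' ∧ ∃ δ : C(ℝ, X), ∀ x, f' x ≠ δ (ht e x)

lemma Avoidable.of_homotopic_of_notMem {f f' : C(sphere (0 : V) 1, X)} (h : f.Homotopic f')
    {y : X} (hy : ∀ x, f' x ≠ y) : Avoidable e f :=
  ⟨f', h, .const _ y, hy⟩

/-- The complement of the diagonal in `X × X` is path connected: move one coordinate at a time in
the complement of the other. Only interchanging two points needs a third point as a parking place.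
-/
lemma exists_paths_ne (hX : ∀ y : X, IsPathConnected ({y}ᶜ : Set X))
    (h3 : ∀ a b : X, ∃ z, z ≠ a ∧ z ≠ b) {a b c d : X}
    (hab : a ≠ b) (hcd : c ≠ d) :
    ∃ (γ₁ : Path a c) (γ₂ : Path b d), ∀ t, γ₁ t ≠ γ₂ t := by
  have h1 : ∀ (u v w : X), v ≠ u → w ≠ u →
      JoinedIn {z : X × X | z.1 ≠ z.2} (u, v) (u, w) := by
    intro u v w hv hw
    obtain ⟨γ, hγ⟩ := (hX u).joinedIn v hv w hw
    exact ⟨γ.map (f := fun z ↦ (u, z)) (by fun_prop), fun t ↦ Ne.symm (hγ t)⟩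
  have h2 : ∀ (u v w : X), v ≠ u → w ≠ u →
      JoinedIn {z : X × X | z.1 ≠ z.2} (v, u) (w, u) := by
    intro u v w hv hw
    obtain ⟨γ, hγ⟩ := (hX u).joinedIn v hv w hw
    exact ⟨γ.map (f := fun z ↦ (z, u)) (by fun_prop), fun t ↦ hγ t⟩
  have h4 : JoinedIn {z : X × X | z.1 ≠ z.2} (a, b) (c, d) := by
    by_cases had : a = d
    · subst had
      by_cases hbc : b = c
      · subst hbc
        obtain ⟨z, hza, hzb⟩ := h3 a b
        exact ((h1 a b z hab.symm hza).trans (h2 z a b hza.symm hzb.symm)).trans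
          (h1 b z a hzb hab)
      · exact (h2 b a c hab (Ne.symm hbc)).trans (h1 c b a hbc hcd.symm)
    · exact (h1 a b d hab.symm (Ne.symm had)).trans (h2 d a c had hcd)
  obtain ⟨γ, hγ⟩ := h4
  exact ⟨γ.map continuous_fst, γ.map continuous_snd, hγ⟩

theorem isLoosePair_of_avoidable (hX : ∀ y : X, IsPathConnected ({y}ᶜ : Set X))
    (h3 : ∀ a b : X, ∃ z, z ≠ a ∧ z ≠ b) {f₁ f₂ : C(sphere (0 : V) 1, X)} (h₁ : Avoidable e f₁) (h₂ : Avoidable (-e) f₂) :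
    IsLoosePair f₁ f₂ := by
  obtain ⟨f₁', hf₁, δ₁, hδ₁⟩ := h₁
  obtain ⟨f₂', hf₂, δ₂, hδ₂⟩ := h₂
  have ha : f₁' (-e) ≠ δ₁ (-1) := by
    have := hδ₁ (-e)
    rwa [ht_neg_right, ht_self] at this
  have hb : f₂' e ≠ δ₂ (-1) := by
    have := hδ₂ e
    rwa [ht_neg_left, ht_self] at this
  -- Across the band the first map goes from `f₁' (-e)` to `δ₂ (-1)` while the second goes from `δ₁
  -- (-1)` to `f₂' e`. Seen from the pole `-e` the second path is traversed backwards.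
  obtain ⟨γ₁, γ₂, hγ⟩ := exists_paths_ne hX h3 ha hb.symm
  refine ⟨withTail e f₁' (glueCurve γ₁ δ₂ rfl) (by rw [glueCurve_of_mem (by simp)]; simp),
    withTail (-e) f₂' (glueCurve γ₂.symm δ₁ rfl) (by rw [glueCurve_of_mem (by simp)]; simp),
    hf₁.trans homotopic_withTail, hf₂.trans homotopic_withTail, ?_⟩
  rw [coincidenceLocus, Set.eq_empty_iff_forall_notMem]
  intro x hx
  rw [Set.mem_ofPred_eq] at hx
  rcases le_or_gt (1 / 2) (ht e x) with h | h
  · have h' : ht (-e) x ≤ -(1 / 2) := by rw [ht_neg_left]; linarith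
    have := (ht_mem e (capMap e x)).1
    rw [withTail_of_ge h, withTail_of_le (by linarith), tailParam_of_le h', neg_neg,
      glueCurve_of_ge (by linarith)] at hx
    exact hδ₁ _ (hx.trans (by congr 1; ring))
  rcases le_or_gt (ht e x) (-(1 / 2)) with h' | h'
  · have h'' : 1 / 2 ≤ ht (-e) x := by rw [ht_neg_left]; linarith
    have := (ht_mem (-e) (capMap (-e) x)).1
    rw [withTail_of_ge h'', withTail_of_le (by linarith), tailParam_of_le h',
      glueCurve_of_ge (by linarith)] at hx
    exact hδ₂ _ (hx.symm.trans (by congr 1; ring))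
  · have h1 : |ht e x| ≤ 1 / 2 := abs_le.mpr ⟨h'.le, h.le⟩
    have h2 : |ht (-e) x| ≤ 1 / 2 := by rwa [ht_neg_left, abs_neg]
    have h3 : 1 / 2 - ht e x ∈ Set.Icc (0 : ℝ) 1 := ⟨by linarith, by linarith⟩
    have h4 : 1 / 2 - ht (-e) x ∈ Set.Icc (0 : ℝ) 1 := by
      rw [ht_neg_left]; exact ⟨by linarith, by linarith⟩
    rw [withTail_of_le h.le, withTail_of_le (by rw [ht_neg_left]; linarith), tailParam_of_abs_le h1,
      tailParam_of_abs_le h2, glueCurve_of_mem h3, glueCurve_of_mem h4, Path.symm_apply] at hx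
    refine hγ _ (hx.trans (congrArg γ₂ ?_))
    ext1
    simp [ht_neg_left]; ring

end Join

/-! ### Closed discrete sets in manifolds and pushing maps off them -/

noncomputable section LocallyEuclidean

open Metric Set Filter Topology

variable {E M : Type*} [NormedAddCommGroup E] [InnerProductSpace ℝ E] [TopologicalSpace M]

/-- Every point of `M` has arbitrarily small open neighbourhoods homeomorphic to `E`. -/
def LocallyModeledOn (E M : Type*) [NormedAddCommGroup E] [TopologicalSpace M] : Prop :=
  ∀ y : M, ∀ U ∈ 𝓝 y, ∃ ι : E → M, IsOpenEmbedding ι ∧ ι 0 = y ∧ range ι ⊆ U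

lemma LocallyModeledOn.of_openPartialHomeomorph
    (h : ∀ y : M, ∃ φ : OpenPartialHomeomorph M E, y ∈ φ.source) : LocallyModeledOn E M := by
  intro y U hU
  obtain ⟨φ, hφ⟩ := h y
  have h1 : φ.target ∩ φ.symm ⁻¹' U ∈ 𝓝 (φ y) := by
    refine inter_mem (φ.open_target.mem_nhds (φ.map_source hφ)) ?_
    refine (φ.continuousAt_symm (φ.map_source hφ)).preimage_mem_nhds ?_
    rwa [φ.left_inv hφ]
  obtain ⟨r, hr, hsub⟩ := Metric.mem_nhds_iff.mp h1
  set b := OpenPartialHomeomorph.univBall (φ y) r with hb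
  have hbs : b.source = univ := OpenPartialHomeomorph.univBall_source _ _
  have hbt : b.target = ball (φ y) r := OpenPartialHomeomorph.univBall_target _ hr
  have hmem : ∀ v, b v ∈ ball (φ y) r := fun v ↦ hbt ▸ b.map_source (hbs ▸ mem_univ v)
  refine ⟨b.trans φ.symm, OpenPartialHomeomorph.isOpenEmbedding _ ?_, ?_, ?_⟩
  · rw [OpenPartialHomeomorph.trans_source, hbs, univ_inter]
    exact eq_univ_of_forall fun v ↦ (hsub (hmem v)).1
  · simp [hb, OpenPartialHomeomorph.univBall_apply_zero, φ.left_inv hφ]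
  · rintro _ ⟨v, rfl⟩
    exact (hsub (hmem v)).2

/-- A subset which is closed and discrete (in a `T₁` space). -/
def LocallySubsingleton (P : Set M) : Prop := ∀ y, ∃ U ∈ 𝓝 y, U ∩ P ⊆ {y}

lemma LocallySubsingleton.mono {P Q : Set M} (hP : LocallySubsingleton P) (h : Q ⊆ P) :
    LocallySubsingleton Q := fun y ↦
  let ⟨U, hU, hUP⟩ := hP y
  ⟨U, hU, (inter_subset_inter_right _ h).trans hUP⟩

lemma locallySubsingleton_singleton [T1Space M] (a : M) : LocallySubsingleton {a} := by
  intro y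
  by_cases h : y = a
  · exact ⟨univ, univ_mem, by simp [h]⟩
  · exact ⟨{a}ᶜ, isOpen_compl_singleton.mem_nhds h, by simp⟩

lemma LocallySubsingleton.isClosed {P : Set M} (hP : LocallySubsingleton P) : IsClosed P := by
  rw [← isOpen_compl_iff, isOpen_iff_mem_nhds]
  intro y hy
  obtain ⟨U, hU, hUP⟩ := hP y
  filter_upwards [hU] with z hz hzP
  have : z = y := hUP ⟨hz, hzP⟩
  exact hy (this ▸ hzP)

lemma LocallySubsingleton.finite_inter {P : Set M} (hP : LocallySubsingleton P) {K : Set M}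
    (hK : IsCompact K) : (K ∩ P).Finite := by
  choose U hU hUP using hP
  obtain ⟨t, -, ht⟩ := hK.elim_nhds_subcover U fun x _ ↦ hU x
  refine t.finite_toSet.subset ?_
  rintro x ⟨hxK, hxP⟩
  obtain ⟨y, hy, hxy⟩ := mem_iUnion₂.mp (ht hxK)
  have : x = y := hUP y ⟨hxy, hxP⟩
  exact this ▸ hy

lemma LocallySubsingleton.dense_compl [Nontrivial E] (hM : LocallyModeledOn E M) {P : Set M}
    (hP : LocallySubsingleton P) : Dense Pᶜ := by
  intro y
  rw [_root_.mem_closure_iff]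
  intro O hO hy
  obtain ⟨U, hU, hUP⟩ := hP y
  obtain ⟨ι, hι, h0, hr⟩ := hM y U hU
  have : (0 : E) ∈ ι ⁻¹' O := by simpa [h0] using hy
  obtain ⟨v, hv, hv0⟩ := (dense_compl_singleton (0 : E)).inter_open_nonempty _
    (hO.preimage hι.continuous) ⟨0, this⟩
  refine ⟨ι v, hv, fun h ↦ hv0 (hι.injective ?_)⟩
  rw [h0]
  exact hUP ⟨hr ⟨v, rfl⟩, h⟩

/-- If two open sets separated `Pᶜ`, the closures of their traces would cover `M` by density and so
share a point `x`. A chart at `x` punctured at `x` is connected, since the dimension is at least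
two, lies in `Pᶜ` and meets both sets. -/
lemma LocallySubsingleton.isPreconnected_compl [PreconnectedSpace M] (hM : LocallyModeledOn E M)
    (hE : 1 < Module.rank ℝ E) {P : Set M} (hP : LocallySubsingleton P) : IsPreconnected Pᶜ := by
  have : Nontrivial E := rank_pos_iff_nontrivial.mp (zero_lt_one.trans hE)
  have hPo : IsOpen Pᶜ := hP.isClosed.isOpen_compl
  rw [isPreconnected_iff_subset_of_disjoint]
  intro A B hA hB hAB hd
  by_contra! hne
  obtain ⟨hnA, hnB⟩ := hne
  have hA' : (Pᶜ ∩ A).Nonempty := by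
    by_contra h
    refine hnB fun x hx ↦ (hAB hx).resolve_left fun hxA ↦ h ⟨x, hx, hxA⟩
  have hB' : (Pᶜ ∩ B).Nonempty := by
    by_contra h
    refine hnA fun x hx ↦ (hAB hx).resolve_right fun hxB ↦ h ⟨x, hx, hxB⟩
  have hcov : (univ : Set M) ⊆ closure (Pᶜ ∩ A) ∪ closure (Pᶜ ∩ B) := by
    rw [← closure_union, ← inter_union_distrib_left, inter_eq_left.mpr hAB,
      (hP.dense_compl hM).closure_eq]
  obtain ⟨x, -, hxA, hxB⟩ := isPreconnected_closed_iff.mp isPreconnected_univ _ _ isClosed_closure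
    isClosed_closure hcov (by simpa using hA'.closure) (by simpa using hB'.closure)
  obtain ⟨U, hU, hUP⟩ := hP x
  obtain ⟨ι, hι, h0, hr⟩ := hM x U hU
  have hW : IsPreconnected (ι '' {0}ᶜ) :=
    (isConnected_compl_singleton_of_one_lt_rank hE 0).isPreconnected.image _
      hι.continuous.continuousOn
  have hWP : ι '' {0}ᶜ ⊆ Pᶜ := by
    rintro _ ⟨v, hv, rfl⟩ h
    exact hv (hι.injective ((hUP ⟨hr ⟨v, rfl⟩, h⟩ : ι v = x).trans h0.symm))
  have hmeet : ∀ O : Set M, IsOpen O → x ∈ closure O → (ι '' {0}ᶜ ∩ O).Nonempty := by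
    intro O hO hx
    obtain ⟨z, hz, hzO⟩ := _root_.mem_closure_iff.mp hx _ hι.isOpen_range ⟨0, h0⟩
    obtain ⟨v, rfl⟩ := hz
    obtain ⟨w, hw, hw0⟩ := (dense_compl_singleton (0 : E)).inter_open_nonempty _
      (hO.preimage hι.continuous) ⟨v, hzO⟩
    exact ⟨ι w, ⟨w, hw0, rfl⟩, hw⟩
  obtain ⟨z, hzW, -, hzA⟩ := hmeet _ (hPo.inter hA) hxA
  obtain ⟨z', hzW', -, hzB⟩ := hmeet _ (hPo.inter hB) hxB
  obtain ⟨w, hw, hwA, hwB⟩ := hW A B hA hB (hWP.trans hAB) ⟨z, hzW, hzA⟩ ⟨z', hzW', hzB⟩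
  have : w ∈ Pᶜ ∩ (A ∩ B) := ⟨hWP hw, hwA, hwB⟩
  rw [hd] at this
  exact this

/-- A family of self-maps of `E` supported in a ball extends along an open embedding. -/
lemma exists_extend_family {E : Type*} [NormedAddCommGroup E] [ProperSpace E] [T2Space M] {A : Type*} [TopologicalSpace A] {ι : E → M}
    (hι : IsOpenEmbedding ι) (Φ : C(A × E, E)) (R : ℝ) (hΦ : ∀ a v, R ≤ ‖v‖ → Φ (a, v) = v) :
    ∃ e : C(A × M, M), (∀ a v, e (a, ι v) = ι (Φ (a, v))) ∧ ∀ a, ∀ y ∉ range ι, e (a, y) = y := by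
  classical
  let f : A × M → M := fun z ↦ if h : z.2 ∈ range ι then ι (Φ (z.1, h.choose)) else z.2
  have h1 : ∀ a v, f (a, ι v) = ι (Φ (a, v)) := by
    intro a v
    have h : ι v ∈ range ι := ⟨v, rfl⟩
    have h2 : h.choose = v := hι.injective h.choose_spec
    simp only [f, dif_pos h, h2]
  have h2 : ∀ a, ∀ y ∉ range ι, f (a, y) = y := fun a y hy ↦ dif_neg hy
  have hg : IsOpenEmbedding (Prod.map id ι : A × E → A × M) := IsOpenEmbedding.id.prodMap hι
  refine ⟨⟨f, continuous_iff_continuousAt.mpr ?_⟩, h1, h2⟩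
  rintro ⟨a, y⟩
  by_cases hy : y ∈ range ι
  · obtain ⟨v, rfl⟩ := hy
    rw [show (a, ι v) = Prod.map id ι (a, v) from rfl, ← hg.continuousAt_iff]
    have : f ∘ Prod.map id ι = ι ∘ Φ := by
      ext ⟨a, v⟩; exact h1 a v
    rw [this]
    exact (hι.continuous.comp Φ.continuous).continuousAt
  -- The support is the image of a compact ball, closed because `M` is Hausdorff, so near a point
  -- outside the chart the family is the projection.
  · have hK : IsClosed (ι '' closedBall 0 R) :=
      ((isCompact_closedBall _ _).image hι.continuous).isClosed
    have hev : ∀ᶠ z : A × M in 𝓝 (a, y), z.2 ∈ (ι '' closedBall 0 R)ᶜ :=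
      continuous_snd.continuousAt.preimage_mem_nhds
        (hK.isOpen_compl.mem_nhds fun ⟨v, _, hv⟩ ↦ hy ⟨v, hv⟩)
    have : f =ᶠ[𝓝 (a, y)] Prod.snd := by
      filter_upwards [hev] with z hz
      obtain ⟨a', y'⟩ := z
      by_cases hy' : y' ∈ range ι
      · obtain ⟨v, rfl⟩ := hy'
        rw [h1, hΦ]
        by_contra! hlt
        exact hz ⟨v, by simpa using hlt.le, rfl⟩
      · exact h2 _ _ hy'
    exact continuousAt_snd.congr this.symm

/-- There is an injective self-map of `M`, homotopic to the identity, fixing `P` and moving `z`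
to `a`. -/
def CanPush (P : Set M) (z a : M) : Prop :=
  ∃ e : C(M, M), Function.Injective e ∧ e z = a ∧ (∀ p ∈ P, e p = p) ∧
    (ContinuousMap.id M).Homotopic e

lemma CanPush.trans {P : Set M} {x y z : M} (h : CanPush P x y) (h' : CanPush P y z) :
    CanPush P x z := by
  obtain ⟨e, he, hxy, hP, hh⟩ := h
  obtain ⟨e', he', hyz, hP', hh'⟩ := h'
  refine ⟨e'.comp e, he'.comp he, by simp [hxy, hyz], fun p hp ↦ by simp [hP p hp, hP' p hp], ?_⟩
  simpa using hh'.comp hh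

/-- The displacement `v ↦ max 0 (1 - ‖v‖) • w` is Lipschitz with constant `‖w‖ < 1`, so adding it to
the identity stays injective. It vanishes outside the unit ball and hence extends to `M`. -/
lemma canPush_of_openEmbedding [ProperSpace E] [T2Space M] {ι : E → M} (hι : IsOpenEmbedding ι)
    {P : Set M} (hP : Disjoint (range ι) P) {w z : E} (hw : ‖w‖ < 1) :
    CanPush P (ι z) (ι (z + max 0 (1 - ‖z‖) • w)) := by
  let Φ : C(I × E, E) := ⟨fun q ↦ q.2 + ((q.1 : ℝ) * max 0 (1 - ‖q.2‖)) • w, by fun_prop⟩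
  obtain ⟨e, he, he'⟩ := exists_extend_family hι Φ 1 fun t v hv ↦ by
    simp [Φ, max_eq_left (sub_nonpos.mpr hv)]
  have hinj : Function.Injective fun v : E ↦ Φ (1, v) := by
    intro u v huv
    simp only [Φ, ContinuousMap.coe_mk, Icc.coe_one, one_mul] at huv
    have h1 : u - v = (max 0 (1 - ‖v‖) - max 0 (1 - ‖u‖)) • w := by
      rw [sub_smul, sub_eq_sub_iff_add_eq_add, huv, add_comm]
    have h2 : |max 0 (1 - ‖v‖) - max 0 (1 - ‖u‖)| ≤ ‖u - v‖ := by
      rw [max_comm 0, max_comm 0]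
      refine (abs_max_sub_max_le_abs _ _ _).trans ?_
      rw [show 1 - ‖v‖ - (1 - ‖u‖) = ‖u‖ - ‖v‖ by ring]
      exact abs_norm_sub_norm_le u v
    have h3 : ‖u - v‖ ≤ ‖u - v‖ * ‖w‖ := by
      conv_lhs => rw [h1, norm_smul]
      exact mul_le_mul_of_nonneg_right h2 (norm_nonneg w)
    have h4 : ‖u - v‖ = 0 := by
      by_contra h
      have : 0 < ‖u - v‖ := lt_of_le_of_ne (norm_nonneg _) (Ne.symm h)
      nlinarith
    exact sub_eq_zero.mp (norm_eq_zero.mp h4)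
  refine ⟨e.curry 1, ?_, ?_, ?_, ⟨
    { toContinuousMap := e
      map_zero_left := ?_
      map_one_left := fun x ↦ rfl }⟩⟩
  · intro x y hxy
    simp only [ContinuousMap.curry_apply] at hxy
    by_cases hx : x ∈ range ι <;> by_cases hy : y ∈ range ι
    · obtain ⟨u, rfl⟩ := hx
      obtain ⟨v, rfl⟩ := hy
      rw [he, he] at hxy
      rw [hinj (hι.injective hxy)]
    · obtain ⟨u, rfl⟩ := hx
      rw [he, he' _ _ hy] at hxy
      exact absurd ⟨_, hxy⟩ hy
    · obtain ⟨v, rfl⟩ := hy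
      rw [he, he' _ _ hx] at hxy
      exact absurd ⟨_, hxy.symm⟩ hx
    · rwa [he' _ _ hx, he' _ _ hy] at hxy
  · simp [he, Φ]
  · exact fun p hp ↦ he' _ _ fun h ↦ hP.ne_of_mem h hp rfl
  · intro x
    by_cases hx : x ∈ range ι
    · obtain ⟨u, rfl⟩ := hx
      simp [he, Φ]
    · simp [he' _ _ hx]

lemma eventually_canPush [ProperSpace E] [T2Space M] (hM : LocallyModeledOn E M) {P : Set M}
    (hP : IsClosed P) {y : M} (hy : y ∉ P) :
    ∀ᶠ z in 𝓝 y, CanPush P y z ∧ CanPush P z y := by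
  obtain ⟨ι, hι, rfl, hr⟩ := hM y _ (hP.isOpen_compl.mem_nhds hy)
  have hd : Disjoint (range ι) P := disjoint_left.mpr hr
  have : ι '' ball 0 (1 / 2) ∈ 𝓝 (ι 0) :=
    hι.isOpenMap.image_mem_nhds (ball_mem_nhds _ (by norm_num))
  filter_upwards [this]
  rintro _ ⟨v, hv, rfl⟩
  rw [mem_ball_zero_iff] at hv
  constructor
  · simpa using canPush_of_openEmbedding hι hd (z := 0) (w := v) (by linarith)
  -- Here `w` solves `(1 - ‖v‖) • w = -v`; the bound `‖v‖ < 1/2` is what makes `‖w‖ < 1`.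
  · have h := canPush_of_openEmbedding hι hd (z := v) (w := -(1 - ‖v‖)⁻¹ • v) (by
      rw [norm_smul, norm_neg, norm_inv, Real.norm_of_nonneg (by linarith),
        inv_mul_lt_iff₀ (by linarith)]
      linarith)
    rwa [max_eq_right (by linarith), smul_smul, mul_neg, mul_inv_cancel₀ (by linarith), neg_smul,
      one_smul, add_neg_cancel] at h

lemma canPush [ProperSpace E] [T2Space M] [PreconnectedSpace M] (hM : LocallyModeledOn E M)
    (hE : 1 < Module.rank ℝ E) {P : Set M} (hP : LocallySubsingleton P) {z a : M} (hz : z ∉ P)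
    (ha : a ∉ P) : CanPush P z a :=
  (hP.isPreconnected_compl hM hE).induction₂' _
    (fun _ hx ↦ (eventually_canPush hM hP.isClosed hx).filter_mono nhdsWithin_le_nhds)
    (fun _ _ _ _ _ _ ↦ CanPush.trans) hz ha

/-- A map from a compact space to a noncompact connected manifold can be pushed off a closed
discrete set. -/
theorem exists_homotopic_avoiding [ProperSpace E] [T2Space M] [PreconnectedSpace M]
    [NoncompactSpace M] (hM : LocallyModeledOn E M) (hE : 1 < Module.rank ℝ E) {P : Set M}
    (hP : LocallySubsingleton P) {X : Type*} [TopologicalSpace X] [CompactSpace X] (F : C(X, M)) :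
    ∃ F' : C(X, M), F.Homotopic F' ∧ ∀ x, F' x ∉ P := by
  have : Nontrivial E := rank_pos_iff_nontrivial.mp (zero_lt_one.trans hE)
  induction hk : (range F ∩ P).ncard using Nat.strong_induction_on generalizing F with
  | _ k ih =>
    have hK := isCompact_range F.continuous
    have hfin := hP.finite_inter hK
    by_cases hne : (range F ∩ P).Nonempty
    · obtain ⟨a, haF, haP⟩ := hne
      obtain ⟨z, hzF, hzP⟩ := (hP.dense_compl hM).inter_open_nonempty _ hK.isClosed.isOpen_compl
        (nonempty_compl.mpr hK.ne_univ)
      have hPa : LocallySubsingleton (P \ {a}) := hP.mono sdiff_subset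
      -- As `e` is injective and takes `z`, which `F` misses, to `a`, the map `e ∘ F` misses `a`. It
      -- hits no new point of `P` because `e` fixes the others, so the number of hit points drops.
      obtain ⟨e, he, hza, hfix, hh⟩ := canPush hM hE hPa (z := z) (a := a)
        (fun h ↦ hzP h.1) (fun h ↦ h.2 rfl)
      have hsub : range (e.comp F) ∩ P ⊆ (range F ∩ P) \ {a} := by
        rintro _ ⟨⟨x, rfl⟩, hx⟩
        have hxa : e (F x) ≠ a := by
          intro h
          exact hzF ⟨x, he (h.trans hza.symm)⟩
        have : F x = e (F x) := he (hfix _ ⟨hx, hxa⟩).symm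
        exact ⟨⟨⟨x, this⟩, hx⟩, hxa⟩
      have hlt : (range (e.comp F) ∩ P).ncard < k := by
        rw [← hk]
        refine (ncard_le_ncard hsub (hfin.subset sdiff_subset)).trans_lt ?_
        exact ncard_sdiff_singleton_lt_of_mem ⟨haF, haP⟩ hfin
      obtain ⟨F', hF', h'⟩ := ih _ hlt (e.comp F) rfl
      refine ⟨F', .trans ?_ hF', h'⟩
      simpa using hh.comp (ContinuousMap.Homotopic.refl F)
    · exact ⟨F, .refl _, fun x hx ↦ hne ⟨F x, ⟨x, rfl⟩, hx⟩⟩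

end LocallyEuclidean

/-! ### Maps from spheres of smaller dimension -/

noncomputable section LowDimension

open Metric Set Filter Topology Module

variable {V : Type*} [NormedAddCommGroup V] [InnerProductSpace ℝ V]

/-- Inverse stereographic projection covers all but one point of the sphere by a `C¹` image of an
`m`-dimensional space. -/
lemma dimH_sphere_le {m : ℕ} (hV : finrank ℝ V = m + 1) (e : sphere (0 : V) 1) :
    dimH (sphere (0 : V) 1) ≤ m := by
  have : Fact (finrank ℝ V = m + 1) := ⟨hV⟩
  have he : ‖(e : V)‖ = 1 := norm_eq_of_mem_sphere e
  have hsub : sphere (0 : V) 1 ⊆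
      range (fun w : (ℝ ∙ (e : V))ᗮ ↦ stereoInvFunAux (e : V) (w : V)) ∪ {(e : V)} := by
    intro x hx
    by_cases hxe : x = e
    · exact Or.inr hxe
    · left
      have : (⟨x, hx⟩ : sphere (0 : V) 1) ∈ range (stereographic he).symm := by
        rw [range_stereographic_symm he e.2]
        intro h
        exact hxe (congrArg Subtype.val h)
      obtain ⟨w, hw⟩ := this
      exact ⟨w, congrArg Subtype.val hw⟩
  have hne : (e : V) ≠ 0 := fun h ↦ by simp [h] at he
  have hfin : finrank ℝ (ℝ ∙ (e : V))ᗮ = m := Submodule.finrank_orthogonal_span_singleton hne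
  have : FiniteDimensional ℝ V := .of_fact_finrank_eq_succ m
  have hc : ContDiff ℝ 1 fun w : (ℝ ∙ (e : V))ᗮ ↦ stereoInvFunAux (e : V) (w : V) :=
    contDiff_stereoInvFunAux.comp (ℝ ∙ (e : V))ᗮ.subtypeL.contDiff
  refine (dimH_mono hsub).trans ?_
  rw [dimH_union, dimH_singleton]
  refine max_le (hc.dimH_range_le.trans ?_) zero_le
  rw [hfin]

/-- Locally a constant approximates `F`; balls are convex, so a smooth partition of unity glues
these constants. -/
lemma exists_contDiff_dist_lt_one [FiniteDimensional ℝ V] {E : Type*} [NormedAddCommGroup E]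
    [NormedSpace ℝ E] (F : C(V, E)) : ∃ G : V → E, ContDiff ℝ 1 G ∧ ∀ x, dist (G x) (F x) < 1 := by
  obtain ⟨g, hg⟩ := exists_contMDiffMap_forall_mem_convex_of_local_const (n := 1) 𝓘(ℝ, V)
    (t := fun x ↦ ball (F x) 1) (fun x ↦ convex_ball _ _) (fun x ↦ ⟨F x, by
      have := F.continuous.continuousAt.eventually (ball_mem_nhds (F x) one_pos)
      filter_upwards [this] with y hy
      rw [mem_ball, dist_comm]
      exact hy⟩)
  exact ⟨g, g.contMDiff.contDiff, hg⟩

variable {E M : Type*} [NormedAddCommGroup E] [InnerProductSpace ℝ E] [FiniteDimensional ℝ E]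
  [TopologicalSpace M] [T2Space M]

/-- A map from a sphere to a manifold of larger dimension is homotopic to a non-surjective map. -/
theorem exists_homotopic_notMem_of_lt (hM : LocallyModeledOn E M) {m : ℕ}
    (hV : finrank ℝ V = m + 1) (hm : m < finrank ℝ E) (e : sphere (0 : V) 1)
    (f : C(sphere (0 : V) 1, M)) :
    ∃ f' : C(sphere (0 : V) 1, M), f.Homotopic f' ∧ ∃ y, ∀ x, f' x ≠ y := by
  have : FiniteDimensional ℝ V := .of_finrank_pos (by omega)
  obtain ⟨ι, hι, -, -⟩ := hM (f e) univ univ_mem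
  set K : Set (sphere (0 : V) 1) := f ⁻¹' (ι '' closedBall 0 3)
  have hK : IsClosed K :=
    ((isCompact_closedBall _ _).image hι.continuous).isClosed.preimage f.continuous
  have hinv : ∀ x : K, ι (Function.invFun ι (f x)) = f x := fun x ↦
    Function.invFun_eq (let ⟨v, _, hv⟩ := x.2; ⟨v, hv⟩)
  let g₀ : C(K, E) := ⟨fun x ↦ Function.invFun ι (f x), by
    rw [hι.isEmbedding.continuous_iff]
    have : (ι ∘ fun x : K ↦ Function.invFun ι (f x)) = fun x : K ↦ f x := funext hinv
    rw [this]; fun_prop⟩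
  have hcl : IsClosedEmbedding fun x : K ↦ ((x : sphere (0 : V) 1) : V) :=
    isClosed_sphere.isClosedEmbedding_subtypeVal.comp hK.isClosedEmbedding_subtypeVal
  have : TietzeExtension E := TietzeExtension.of_tvs ℝ
  obtain ⟨F, hF⟩ := g₀.exists_extension hcl
  obtain ⟨G, hG, hGF⟩ := exists_contDiff_dist_lt_one F
  have hF' : ∀ (x : sphere (0 : V) 1) (v : E), ‖v‖ ≤ 3 → f x = ι v → F x = v := by
    intro x v hv hx
    have hxK : x ∈ K := ⟨v, by simpa using hv, hx.symm⟩
    have := DFunLike.congr_fun hF ⟨x, hxK⟩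
    refine this.trans (hι.injective ((hinv ⟨x, hxK⟩).trans hx))
  have hdense : Dense (G '' sphere (0 : V) 1)ᶜ :=
    hG.contDiffOn.dense_compl_image_of_dimH_lt_finrank convex_univ (subset_univ _)
      ((dimH_sphere_le hV e).trans_lt (by exact_mod_cast hm))
  obtain ⟨v, hv, hvG⟩ := hdense.inter_open_nonempty _ isOpen_ball
    ⟨(0 : E), mem_ball_self (by norm_num : (0 : ℝ) < 1)⟩
  rw [mem_ball_zero_iff] at hv
  -- In the chart, `f x` is dragged towards `G x` with a cutoff equal to 1 on radius at most 2 and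
  -- to 0 from radius 3 on. A point moves by at most 1, so one that lands on `v`, where `‖v‖ < 1`,
  -- started within radius 2; there the cutoff is 1 and it lands on `G x ≠ v`.
  let Φ : C((I × sphere (0 : V) 1) × E, E) :=
    ⟨fun q ↦ q.2 + ((q.1.1 : ℝ) * max 0 (min 1 (3 - ‖q.2‖))) • (G q.1.2 - q.2), by
      have := hG.continuous
      fun_prop⟩
  obtain ⟨h, hh, hh'⟩ := exists_extend_family hι Φ 3 fun a v hv ↦ by
    have : min 1 (3 - ‖v‖) ≤ 0 := (min_le_right _ _).trans (by linarith)
    simp [Φ, max_eq_left this]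
  let H : C(I × sphere (0 : V) 1, M) := h.comp ⟨fun q ↦ (q, f q.2), by fun_prop⟩
  refine ⟨H.curry 1, ⟨{ toContinuousMap := H, map_zero_left := fun x ↦ ?_,
                        map_one_left := fun x ↦ rfl }⟩, ι v, fun x hx ↦ ?_⟩
  · change h ((0, x), f x) = f x
    by_cases hx : f x ∈ range ι
    · obtain ⟨u, hu⟩ := hx
      rw [← hu, hh]
      simp [Φ]
    · exact hh' _ _ hx
  · change h ((1, x), f x) = ι v at hx
    by_cases hxr : f x ∈ range ι
    · obtain ⟨u, hu⟩ := hxr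
      rw [← hu, hh] at hx
      have hx := hι.injective hx
      simp only [Φ, ContinuousMap.coe_mk, Icc.coe_one, one_mul] at hx
      set c := max 0 (min 1 (3 - ‖u‖)) with hc
      have hc0 : 0 ≤ c := le_max_left _ _
      have hc1 : c ≤ 1 := max_le zero_le_one (min_le_left _ _)
      have hu3 : ‖u‖ < 3 := by
        by_contra! h3
        have : c = 0 := max_eq_left ((min_le_right _ _).trans (by linarith))
        rw [this, zero_smul, add_zero] at hx
        rw [hx] at h3
        linarith
      have hFu := hF' x u hu3.le hu.symm
      have hGu : ‖G x - u‖ < 1 := by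
        have := hGF x
        rwa [hFu, dist_eq_norm] at this
      have hu2 : ‖u‖ < 2 := by
        have h1 : u = v - c • (G x - u) := by rw [← hx]; abel
        have h2 : ‖c • (G x - u)‖ ≤ 1 := by
          rw [norm_smul, Real.norm_of_nonneg hc0]
          nlinarith [norm_nonneg (G x - u)]
        calc ‖u‖ = ‖v - c • (G x - u)‖ := congrArg _ h1
          _ ≤ ‖v‖ + ‖c • (G x - u)‖ := norm_sub_le _ _
          _ < 2 := by linarith
      have hc2 : c = 1 := by
        rw [hc, min_eq_left (by linarith), max_eq_right zero_le_one]
      rw [hc2, one_smul, add_sub_cancel] at hx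
      exact hvG ⟨x, x.2, hx⟩
    · rw [hh' _ _ hxr] at hx
      exact hxr ⟨v, hx.symm⟩

end LowDimension

/-! ### The universal cover as a bundle with discrete fibre -/

noncomputable section UniversalCover

open Set Filter Topology CategoryTheory

universe u

variable {N : Type*} [TopologicalSpace N]

/-- Any two paths in `U` with the same end points are homotopic in the ambient space. -/
def IsRelativelySimple (U : Set N) : Prop :=
  ∀ ⦃a b : N⦄ (γ γ' : Path a b), range γ ⊆ U → range γ' ⊆ U → γ.Homotopic γ'

/-- Paths in the range pull back to the vector space `E`, which is simply connected. -/
lemma isRelativelySimple_range {E : Type*} [NormedAddCommGroup E] [NormedSpace ℝ E] {ι : E → N}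
    (hι : IsEmbedding ι) : IsRelativelySimple (range ι) := by
  intro a b γ γ' h h'
  have key : ∀ (δ : Path a b), range δ ⊆ range ι →
      ∃ δ' : C(I, E), ∀ t, ι (δ' t) = δ t := by
    intro δ hδ
    refine ⟨⟨fun t ↦ Function.invFun ι (δ t), ?_⟩, fun t ↦ Function.invFun_eq (hδ ⟨t, rfl⟩)⟩
    rw [hι.continuous_iff]
    have : (ι ∘ fun t ↦ Function.invFun ι (δ t)) = δ :=
      funext fun t ↦ Function.invFun_eq (hδ ⟨t, rfl⟩)
    rw [this]
    exact δ.continuous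
  obtain ⟨u, rfl⟩ := h ⟨0, γ.source⟩
  obtain ⟨v, rfl⟩ := h ⟨1, γ.target⟩
  obtain ⟨δ, hδ⟩ := key γ h
  obtain ⟨δ', hδ'⟩ := key γ' h'
  let p : Path u v := ⟨δ, hι.injective ((hδ 0).trans γ.source), hι.injective ((hδ 1).trans γ.target)⟩
  let p' : Path u v :=
    ⟨δ', hι.injective ((hδ' 0).trans γ'.source), hι.injective ((hδ' 1).trans γ'.target)⟩
  have hpp : p.Homotopic p' := SimplyConnectedSpace.paths_homotopic p p'
  have := hpp.map ⟨ι, hι.continuous⟩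
  have h1 : γ = p.map hι.continuous := Path.ext (funext fun t ↦ (hδ t).symm)
  have h2 : γ' = p'.map hι.continuous := Path.ext (funext fun t ↦ (hδ' t).symm)
  rw [h1, h2]
  exact this

/-- A cover of a path-connected space by open path-connected relatively simple sets. -/
structure SimpleCover (N : Type*) [TopologicalSpace N] where
  U : N → Set N
  isOpen : ∀ x, IsOpen (U x)
  mem : ∀ x, x ∈ U x
  pathConnected : ∀ x, IsPathConnected (U x)
  simple : ∀ x, IsRelativelySimple (U x)

namespace SimpleCover

variable (𝓤 : SimpleCover N) (y₀ : N)

/-- The arrow of the fundamental groupoid given by a path. -/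
abbrev arrow {x y : N} (γ : Path x y) : FundamentalGroupoid.mk x ⟶ FundamentalGroupoid.mk y :=
  Path.Homotopic.Quotient.mk γ

lemma arrow_trans {x y z : N} (γ : Path x y) (δ : Path y z) :
    arrow (γ.trans δ) = arrow γ ≫ arrow δ := rfl

lemma arrow_congr {x y : N} {γ δ : Path x y} (h : γ.Homotopic δ) : arrow γ = arrow δ :=
  Path.Homotopic.Quotient.eq.mpr h

variable [PathConnectedSpace N]

open Classical in
/-- The class of the paths from the base point to `x` going through the centre of `U i`. -/
def sec (i x : N) : FundamentalGroupoid.mk y₀ ⟶ FundamentalGroupoid.mk x :=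
  if h : JoinedIn (𝓤.U i) i x then arrow (PathConnectedSpace.somePath y₀ i) ≫ arrow h.somePath
  -- A default value: the trivialization with index `i` is only used over `U i`.
  else arrow (PathConnectedSpace.somePath y₀ x)

variable {y₀}

lemma sec_eq {i x x' : N} (γ : Path x x') (hγ : range γ ⊆ 𝓤.U i) :
    𝓤.sec y₀ i x' = 𝓤.sec y₀ i x ≫ arrow γ := by
  have hx : x ∈ 𝓤.U i := hγ ⟨0, γ.source⟩
  have hx' : x' ∈ 𝓤.U i := hγ ⟨1, γ.target⟩
  have h := (𝓤.pathConnected i).joinedIn i (𝓤.mem i) x hx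
  have h' := (𝓤.pathConnected i).joinedIn i (𝓤.mem i) x' hx'
  rw [sec, sec, dif_pos h, dif_pos h', Category.assoc, ← arrow_trans h.somePath]
  congr 1
  refine arrow_congr (𝓤.simple i _ _ ?_ ?_)
  · rintro _ ⟨t, rfl⟩; exact h'.somePath_mem t
  · rw [Path.trans_range]
    refine union_subset ?_ hγ
    rintro _ ⟨t, rfl⟩; exact h.somePath_mem t

variable (y₀)

/-- The fibre of the universal cover, with the discrete topology. -/
@[ext]
structure CoverFiber (y₀ : N) where
  hom : FundamentalGroupoid.mk y₀ ⟶ FundamentalGroupoid.mk y₀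

instance : TopologicalSpace (CoverFiber y₀) := ⊥

instance : DiscreteTopology (CoverFiber y₀) := ⟨rfl⟩

/-- The transition functions of the universal cover. -/
def change (i j x : N) (v : CoverFiber y₀) : CoverFiber y₀ :=
  ⟨v.hom ≫ 𝓤.sec y₀ i x ≫ inv (𝓤.sec y₀ j x)⟩

/-- Moving along `γ` multiplies both sections by the same arrow, which cancels. Hence the transition
functions are locally constant, as a discrete fibre requires. -/
lemma change_eq {i j x x' : N} (γ : Path x x') (hi : range γ ⊆ 𝓤.U i) (hj : range γ ⊆ 𝓤.U j) :
    𝓤.change y₀ i j x' = 𝓤.change y₀ i j x := by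
  funext v
  simp only [change, 𝓤.sec_eq γ hi, 𝓤.sec_eq γ hj]
  simp

/-- The universal cover as a fibre bundle. -/
def core [LocallyPathConnectedSpace N] : FiberBundleCore N N (CoverFiber y₀) where
  baseSet := 𝓤.U
  isOpen_baseSet := 𝓤.isOpen
  indexAt := id
  mem_baseSet_at := 𝓤.mem
  coordChange := 𝓤.change y₀
  coordChange_self i x _ v := by simp [change]
  continuousOn_coordChange i j := by
    rintro ⟨x, v⟩ ⟨hx, -⟩
    refine ContinuousAt.continuousWithinAt ?_
    obtain ⟨W, ⟨hW, hWc⟩, hWU⟩ := (path_connected_basis x).mem_iff.mp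
      (((𝓤.isOpen i).inter (𝓤.isOpen j)).mem_nhds hx)
    have h1 : ∀ᶠ p : N × CoverFiber y₀ in 𝓝 (x, v), p.1 ∈ W ∧ p.2 = v := by
      rw [nhds_prod_eq, nhds_discrete (CoverFiber y₀)]
      exact Filter.Eventually.prod_mk (pa := (· ∈ W)) (pb := (· = v)) hW (eventually_pure.mpr rfl)
    refine ContinuousAt.congr (continuousAt_const (y := 𝓤.change y₀ i j x v)) ?_
    filter_upwards [h1] with ⟨x', v'⟩ ⟨hx', hv'⟩
    simp only at hx' hv'
    subst hv'
    have h := hWc.joinedIn x (mem_of_mem_nhds hW) x' hx'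
    have hr : range h.somePath ⊆ W := by rintro _ ⟨t, rfl⟩; exact h.somePath_mem t
    exact (congrFun (𝓤.change_eq y₀ h.somePath (hr.trans (hWU.trans inter_subset_left))
      (hr.trans (hWU.trans inter_subset_right))) v').symm
  coordChange_comp i j k x _ v := by simp [change]

variable [LocallyPathConnectedSpace N]

/-- The total space of the universal cover. -/
abbrev Cover := (𝓤.core y₀).TotalSpace

lemma isCoveringMap_proj : IsCoveringMap (𝓤.core y₀).proj :=
  IsFiberBundle.isCoveringMap fun x ↦ ⟨(𝓤.core y₀).localTriv x, 𝓤.mem x⟩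

variable {y₀}

/-- The point of the universal cover given by the class of a path. -/
def point {x : N} (γ : Path y₀ x) : 𝓤.Cover y₀ :=
  ⟨x, (⟨arrow γ ≫ inv (𝓤.sec y₀ x x)⟩ : CoverFiber y₀)⟩

lemma point_congr {x x' : N} {γ : Path y₀ x} {γ' : Path y₀ x'} (h : ∀ t, γ t = γ' t) :
    𝓤.point γ = 𝓤.point γ' := by
  have hx : x = x' := by rw [← γ.target, ← γ'.target, h]
  subst hx
  congr
  ext t
  exact h t

lemma exists_point (z : 𝓤.Cover y₀) : ∃ (x : N) (γ : Path y₀ x), 𝓤.point γ = z := by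
  obtain ⟨x, v : CoverFiber y₀⟩ := z
  obtain ⟨γ, hγ⟩ := Path.Homotopic.Quotient.mk_surjective (v.hom ≫ 𝓤.sec y₀ x x)
  refine ⟨x, γ, ?_⟩
  have h1 : arrow γ = v.hom ≫ 𝓤.sec y₀ x x := hγ
  rw [point, h1, Category.assoc, IsIso.hom_inv_id, Category.comp_id]

/-- This is the lift of `γ` to the cover. Near `t₀` its fibre coordinate over `U (γ t₀)` is
constant, since the class of the initial subpath and the section change by the same short arrow. It
makes the cover path connected. -/
lemma continuous_point_subpath {x : N} (γ : Path y₀ x) :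
    Continuous fun t : I ↦ 𝓤.point ((γ.subpath 0 t).cast γ.source.symm rfl) := by
  rw [continuous_iff_continuousAt]
  intro t₀
  set c := γ t₀
  have hU : γ ⁻¹' 𝓤.U c ∈ 𝓝 t₀ :=
    γ.continuous.continuousAt.preimage_mem_nhds ((𝓤.isOpen c).mem_nhds (𝓤.mem c))
  obtain ⟨r, hr, hball⟩ := Metric.mem_nhds_iff.mp hU
  have hsub : ∀ t ∈ Metric.ball t₀ r, range (γ.subpath t₀ t) ⊆ 𝓤.U c := by
    intro t ht
    rw [Path.range_subpath]
    rintro _ ⟨s, hs, rfl⟩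
    refine hball ?_
    rw [Metric.mem_ball, Subtype.dist_eq, Real.dist_eq] at ht ⊢
    refine lt_of_le_of_lt ?_ ht
    have : (s : ℝ) ∈ uIcc (t₀ : ℝ) t := by
      rcases le_total t₀ t with h | h
      · rw [uIcc_of_le h] at hs
        rw [uIcc_of_le (by exact_mod_cast h)]
        exact ⟨hs.1, hs.2⟩
      · rw [uIcc_of_ge h] at hs
        rw [uIcc_of_ge (by exact_mod_cast h)]
        exact ⟨hs.1, hs.2⟩
    exact abs_sub_left_of_mem_uIcc this
  refine (((𝓤.core y₀).localTriv c).toOpenPartialHomeomorph.continuousAt_iff_continuousAt_comp_left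
    hU).mpr ?_
  have hcont : ContinuousAt (fun t : I ↦ ((γ t,
      ⟨arrow ((γ.subpath 0 t₀).cast γ.source.symm rfl) ≫ inv (𝓤.sec y₀ c c)⟩) :
      N × CoverFiber y₀)) t₀ := by fun_prop
  refine hcont.congr ?_
  filter_upwards [Metric.ball_mem_nhds t₀ hr] with t ht
  have h1 : 𝓤.sec y₀ c (γ t) = 𝓤.sec y₀ c c ≫ arrow (γ.subpath t₀ t) := 𝓤.sec_eq _ (hsub t ht)
  have h2 : arrow ((γ.subpath 0 t).cast γ.source.symm rfl) =
      arrow ((γ.subpath 0 t₀).cast γ.source.symm rfl) ≫ arrow (γ.subpath t₀ t) := by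
    rw [← arrow_trans]
    refine arrow_congr ?_
    have := (Path.Homotopic.symm ⟨Path.Homotopy.subpathTransSubpath γ 0 t₀ t⟩).pathCast
      γ.source.symm (rfl : γ t = γ t)
    exact this
  refine Prod.ext rfl ?_
  change _ = 𝓤.change y₀ (γ t) c (γ t) _
  simp only [change, h1, h2, point]
  simp

lemma joined_point {x : N} (γ : Path y₀ x) : Joined (𝓤.point (Path.refl y₀)) (𝓤.point γ) := by
  refine ⟨⟨⟨_, 𝓤.continuous_point_subpath γ⟩, 𝓤.point_congr fun t ↦ ?_, 𝓤.point_congr fun t ↦ ?_⟩⟩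
  · simp
  · simp

instance : PathConnectedSpace (𝓤.Cover y₀) := by
  refine ⟨⟨𝓤.point (Path.refl y₀)⟩, fun z w ↦ ?_⟩
  obtain ⟨x, γ, rfl⟩ := 𝓤.exists_point z
  obtain ⟨x', γ', rfl⟩ := 𝓤.exists_point w
  exact (𝓤.joined_point γ).symm.trans (𝓤.joined_point γ')

end SimpleCover

/-- The universal cover of a connected manifold. -/
theorem exists_connected_covering {E : Type*} {N : Type u} [NormedAddCommGroup E] [NormedSpace ℝ E]
    [TopologicalSpace N] [T2Space N] [PathConnectedSpace N] [LocallyPathConnectedSpace N]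
    (hN : LocallyModeledOn E N) (y₀ : N) [Infinite (FundamentalGroup N y₀)] :
    ∃ (M : Type u) (_ : TopologicalSpace M) (q : C(M, N)), IsCoveringMap q ∧
      Function.Surjective q ∧ PathConnectedSpace M ∧ T2Space M ∧ (q ⁻¹' {y₀}).Infinite := by
  choose ι hι h0 _ using fun x : N ↦ hN x univ univ_mem
  let 𝓤 : SimpleCover N :=
    { U := fun x ↦ range (ι x)
      isOpen := fun x ↦ (hι x).isOpen_range
      mem := fun x ↦ ⟨0, h0 x⟩
      pathConnected := fun x ↦ isPathConnected_range (hι x).continuous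
      simple := fun x ↦ isRelativelySimple_range (hι x).isEmbedding }
  have hcov := 𝓤.isCoveringMap_proj y₀
  refine ⟨𝓤.Cover y₀, inferInstance, ⟨(𝓤.core y₀).proj, hcov.continuous⟩, hcov, ?_, inferInstance,
    ?_, ?_⟩
  · exact fun x ↦ ⟨⟨x, (⟨𝟙 (FundamentalGroupoid.mk y₀)⟩ : SimpleCover.CoverFiber y₀)⟩, rfl⟩
  · refine ⟨fun z w hzw ↦ ?_⟩
    by_cases h : (𝓤.core y₀).proj z = (𝓤.core y₀).proj w
    · exact hcov.isSeparatedMap z w h hzw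
    · exact separated_by_continuous hcov.continuous h
  · refine infinite_of_injective_forall_mem (α := FundamentalGroup N y₀)
      (f := fun v ↦ (⟨y₀, (⟨v⟩ : SimpleCover.CoverFiber y₀)⟩ : 𝓤.Cover y₀)) ?_ fun v ↦ rfl
    intro v w h
    exact congrArg SimpleCover.CoverFiber.hom (eq_of_heq (Bundle.TotalSpace.mk.inj h).2)

end UniversalCover

/-! ### Infinite fundamental group -/

noncomputable section InfiniteFundamentalGroup

open Set Filter Topology Metric Module

variable {V : Type*} [NormedAddCommGroup V] [InnerProductSpace ℝ V]

/-- Folds the sphere onto its upper hemisphere. -/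
def foldFamily : AxialFamily where
  α _ a := |a|
  β _ _ := 1
  cα := by fun_prop
  cβ := by fun_prop
  pos t _ a _ := by simp

lemma norm_vec_foldFamily (e : sphere (0 : V) 1) (t : I) (x : sphere (0 : V) 1) :
    ‖foldFamily.vec (e : V) t x‖ = 1 := by
  have h := norm_sq_axial (norm_eq_of_mem_sphere e) |ht e x| 1 (norm_eq_of_mem_sphere x)
  rw [sq_abs, one_pow, one_mul, sub_add_cancel] at h
  exact (pow_eq_one_iff_of_nonneg (norm_nonneg _) two_ne_zero).mp h

lemma ht_fold (e : sphere (0 : V) 1) (t : I) (x : sphere (0 : V) 1) :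
    ht e (foldFamily.map e (t, x)) = |ht e x| := by
  have := foldFamily.height_map e t x
  rw [norm_vec_foldFamily, inv_one, one_mul] at this
  exact this

/-- The fold of the sphere onto its closed upper hemisphere. -/
def fold (e : sphere (0 : V) 1) : C(sphere (0 : V) 1, {x : sphere (0 : V) 1 // 0 ≤ ht e x}) where
  toFun x := ⟨foldFamily.map e (0, x), by rw [ht_fold]; positivity⟩

lemma coe_fold_of_nonneg {e x : sphere (0 : V) 1} (h : 0 ≤ ht e x) :
    (fold e x : sphere (0 : V) 1) = x :=
  foldFamily.map_eq_self (abs_of_nonneg h) rfl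

lemma isConnected_equator {m : ℕ} (hV : finrank ℝ V = m + 1) (hm : 2 ≤ m)
    (e : sphere (0 : V) 1) : IsConnected {x : sphere (0 : V) 1 | ht e x = 0} := by
  have : Fact (finrank ℝ V = m + 1) := ⟨hV⟩
  have he : ‖(e : V)‖ = 1 := norm_eq_of_mem_sphere e
  have hne : (e : V) ≠ 0 := fun h ↦ by simp [h] at he
  have hfin : finrank ℝ (ℝ ∙ (e : V))ᗮ = m := Submodule.finrank_orthogonal_span_singleton hne
  have hrank : 1 < Module.rank ℝ (ℝ ∙ (e : V))ᗮ := one_lt_rank_of_one_lt_finrank (by omega)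
  have := isConnected_iff_connectedSpace.mp
    (isConnected_sphere hrank (0 : (ℝ ∙ (e : V))ᗮ) zero_le_one)
  let j : sphere (0 : (ℝ ∙ (e : V))ᗮ) 1 → sphere (0 : V) 1 :=
    fun w ↦ ⟨((w : (ℝ ∙ (e : V))ᗮ) : V), by
      rw [mem_sphere_zero_iff_norm]; exact norm_eq_of_mem_sphere w⟩
  have hj : Continuous j := by fun_prop
  convert isConnected_range hj using 1
  ext x
  constructor
  · intro hx
    have hxe : (x : V) ∈ (ℝ ∙ (e : V))ᗮ := by
      rw [Submodule.mem_orthogonal_singleton_iff_inner_left]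
      exact hx
    exact ⟨⟨⟨x, hxe⟩, by simp⟩, rfl⟩
  · rintro ⟨w, rfl⟩
    exact Submodule.mem_orthogonal_singleton_iff_inner_left.mp w.1.2

/-- A map from a sphere of dimension at least two lifts to coverings, up to a collapse. -/
lemma exists_lift_comp_collapse {M N : Type*} [TopologicalSpace M] [TopologicalSpace N] {q : C(M, N)}
    (hq : IsCoveringMap q) (hs : Function.Surjective q) {m : ℕ} (hV : finrank ℝ V = m + 1)
    (hm : 2 ≤ m) (e : sphere (0 : V) 1) (f : C(sphere (0 : V) 1, N)) :
    ∃ F : C(sphere (0 : V) 1, M), ∀ x, q (F x) = f (collapse e (1, x)) := by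
  have hT := isConnected_equator hV hm e
  obtain ⟨z, hz⟩ := hs (f e)
  -- On the upper hemisphere `f ∘ collapse e` is contracted to the constant `f e`; the contraction
  -- is run backwards so that its lift can start at the constant `z`.
  let H : C(I × {x : sphere (0 : V) 1 // 0 ≤ ht e x}, N) :=
    ⟨fun p ↦ f (collapse e (1, collapse (-e) (unitInterval.symm p.1, p.2))), by fun_prop⟩
  have hH : ∀ a, H (0, a) = q (ContinuousMap.const _ z a) := by
    intro a
    simp only [H, ContinuousMap.coe_mk, unitInterval.symm_zero, ContinuousMap.const_apply, hz]
    rw [collapse_neg_one_of_nonneg a.2, collapseFamily.map_pole (by norm_num [collapseFamily])]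
  let L := hq.liftHomotopy H (.const _ z) hH
  have hL : ∀ p, q (L p) = H p := fun p ↦ congrFun (hq.liftHomotopy_lifts H (.const _ z) hH) p
  let L₁ : C(sphere (0 : V) 1, M) := ⟨fun x ↦ L (1, fold e x), by fun_prop⟩
  have hL₁ : ∀ x, 0 ≤ ht e x → q (L₁ x) = f (collapse e (1, x)) := by
    intro x hx
    change q (L (1, fold e x)) = _
    rw [hL]
    simp only [H, ContinuousMap.coe_mk, unitInterval.symm_one, collapse_zero, coe_fold_of_nonneg hx]
  -- On the equator the lift covers a constant map, and the equator is connected because `m ≥ 2`, so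
  -- the lift is constant there and extends by a constant over the lower hemisphere.
  have hconst : ∀ x y, ht e x = 0 → ht e y = 0 → L₁ x = L₁ y := by
    intro x y hx hy
    refine hq.constOn_of_comp hT.isPreconnected L₁.continuous.continuousOn ?_ hx hy
    intro a ha b hb
    rw [hL₁ a ha.ge, hL₁ b hb.ge,
      collapse_one_of_nonpos ha.le, collapse_one_of_nonpos hb.le]
  obtain ⟨x₀, hx₀ : ht e x₀ = 0⟩ := hT.nonempty
  refine ⟨⟨fun x ↦ if ht e x ≤ 0 then L₁ x₀ else L₁ x, ?_⟩, fun x ↦ ?_⟩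
  · exact Continuous.if_le continuous_const L₁.continuous (continuous_ht e) continuous_const
      fun x hx ↦ hconst _ _ hx₀ hx
  · simp only [ContinuousMap.coe_mk]
    split_ifs with h
    · rw [hL₁ _ hx₀.ge, collapse_one_of_nonpos hx₀.le, collapse_one_of_nonpos h]
    · exact hL₁ x (not_le.mp h).le

/-- If the fundamental group is infinite, every map from a sphere of dimension at least two is
homotopic to a non-surjective map. -/
theorem exists_homotopic_notMem_of_infinite {E N : Type*} [NormedAddCommGroup E]
    [InnerProductSpace ℝ E] [FiniteDimensional ℝ E] [TopologicalSpace N] [T2Space N]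
    [PathConnectedSpace N] [LocallyPathConnectedSpace N]
    (hN : LocallyModeledOn E N) (hE : 1 < Module.rank ℝ E) (y₀ : N)
    [Infinite (FundamentalGroup N y₀)] {m : ℕ} (hV : finrank ℝ V = m + 1)
    (hm : 2 ≤ m) (e : sphere (0 : V) 1) (f : C(sphere (0 : V) 1, N)) :
    ∃ f' : C(sphere (0 : V) 1, N), f.Homotopic f' ∧ ∃ y, ∀ x, f' x ≠ y := by
  obtain ⟨M, _, q, hq, hs, _, _, hinf⟩ := exists_connected_covering hN y₀
  have hP : LocallySubsingleton (q ⁻¹' {y₀}) := by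
    intro x
    by_cases hx : q x = y₀
    · obtain ⟨φ, hxφ, hφ⟩ := hq.isLocalHomeomorph x
      refine ⟨φ.source, φ.open_source.mem_nhds hxφ, ?_⟩
      rintro z ⟨hz, hzy⟩
      refine φ.injOn hz hxφ ?_
      rw [← hφ, hx]
      exact hzy
    · refine ⟨(q ⁻¹' {y₀})ᶜ, ((isClosed_singleton.preimage q.continuous).isOpen_compl).mem_nhds hx,
        by simp⟩
  have hM : LocallyModeledOn E M := by
    refine .of_openPartialHomeomorph fun x ↦ ?_
    obtain ⟨φ, hxφ, hφ⟩ := hq.isLocalHomeomorph x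
    obtain ⟨ι, hι, h0, -⟩ := hN (q x) univ univ_mem
    refine ⟨φ.trans (hι.toOpenPartialHomeomorph ι).symm, ?_⟩
    rw [OpenPartialHomeomorph.trans_source]
    refine ⟨hxφ, ?_⟩
    rw [← hφ]
    simpa using ⟨0, h0⟩
  have : NoncompactSpace M := by
    refine ⟨fun h ↦ hinf ?_⟩
    simpa using hP.finite_inter h
  have : FiniteDimensional ℝ V := .of_finrank_pos (by omega)
  obtain ⟨F, hF⟩ := exists_lift_comp_collapse hq hs hV hm e f
  obtain ⟨F', hFF', hF'⟩ := exists_homotopic_avoiding hM hE hP F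
  refine ⟨q.comp F', (homotopic_comp_collapse e f).trans ?_, y₀, hF'⟩
  have : f.comp ((collapse e).curry 1) = q.comp F := by
    ext x; exact (hF x).symm
  rw [this]
  exact .comp (.refl q) hFF'

end InfiniteFundamentalGroup

/-! ### Relative homotopy lifting for discs -/

noncomputable section Fibration

open Set Filter Topology Metric

/-- Positive dimension enters the argument only as the existence of two points. -/
lemma nontrivial_of_smallInductiveDimension_pos {X : Type*} [TopologicalSpace X]
    (h : 0 < smallInductiveDimension X) : Nontrivial X := by
  by_contra hn
  rw [not_nontrivial_iff_subsingleton] at hn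
  have : HasSmallInductiveDimensionLE X 0 := by
    refine hasSmallInductiveDimensionLT_one_iff.mpr ?_
    have : {s : Set X | IsClopen s} = {s | IsOpen s} := by
      ext s
      exact ⟨fun h ↦ h.2, fun h ↦ by
        rcases Set.eq_empty_or_nonempty s with rfl | ⟨x, hx⟩
        · exact isClopen_empty
        · rw [show s = univ from eq_univ_of_forall fun y ↦ Subsingleton.elim x y ▸ hx]
          exact isClopen_univ⟩
    rw [this]
    exact TopologicalSpace.isTopologicalBasis_opens
  exact absurd h (not_lt.mpr (smallInductiveDimension_le_iff.mpr this))

/-- The homotopy lifting property of `p` for the space `X`. -/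
def HasHomotopyLifting {E B : Type*} [TopologicalSpace E] [TopologicalSpace B] (p : C(E, B))
    (X : Type*) [TopologicalSpace X] : Prop :=
  ∀ (H : C(X × I, B)) (g : C(X, E)), (∀ x, p (g x) = H (x, 0)) →
    ∃ G : C(X × I, E), (∀ x, G (x, 0) = g x) ∧ ∀ z, p (G z) = H z

variable {N B : Type*} [TopologicalSpace N] [TopologicalSpace B] {p : C(N, B)}

lemma HasHomotopyLifting.of_retract {X Z : Type*} [TopologicalSpace X] [TopologicalSpace Z]
    (h : HasHomotopyLifting p Z) (i : C(X, Z)) (r : C(Z, X)) (hr : ∀ x, r (i x) = x) :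
    HasHomotopyLifting p X := by
  intro H g hg
  obtain ⟨G, hG, hG'⟩ := h (H.comp (r.prodMap (.id I))) (g.comp r) fun z ↦ hg (r z)
  refine ⟨G.comp (i.prodMap (.id I)), fun x ↦ ?_, fun z ↦ ?_⟩
  · exact (hG (i x)).trans (congrArg g (hr x))
  · exact (hG' _).trans (congrArg H (Prod.ext (hr z.1) rfl))

/-- Lifts given on a suitable deformation retract can be extended. -/
lemma HasHomotopyLifting.exists_extension {Z : Type*} [TopologicalSpace Z]
    (h : HasHomotopyLifting p Z) (A : Set Z) (φ : C(Z, I)) (d : C(Z × I, Z))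
    (hd : ∀ z, d (z, 0) ∈ A) (hφ : ∀ z, d (z, φ z) = z) (hA : ∀ z ∈ A, φ z = 0)
    (H : C(Z, B)) (g : C(A, N)) (hg : ∀ z, p (g z) = H z) :
    ∃ G : C(Z, N), (∀ z, p (G z) = H z) ∧ ∀ z : A, G z = g z := by
  obtain ⟨G, hG, hG'⟩ := h (H.comp d) (g.comp ⟨fun z ↦ ⟨d (z, 0), hd z⟩, by fun_prop⟩)
    fun z ↦ hg _
  -- The path `d (z, ·)` runs from `A` and reaches `z` at time `φ z`; its lift is evaluated there.
  refine ⟨⟨fun z ↦ G (z, φ z), by fun_prop⟩, fun z ↦ ?_, fun z ↦ ?_⟩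
  · exact (hG' _).trans (congrArg H (hφ z))
  · have h1 : d ((z : Z), 0) = z := by
      conv_rhs => rw [← hφ z, hA z z.2]
    simp only [ContinuousMap.coe_mk, hA z z.2, hG]
    exact congrArg g (Subtype.ext h1)

section Disc

variable {V : Type*} [NormedAddCommGroup V] [InnerProductSpace ℝ V]

/-- The closed unit disc orthogonal to `e`. -/
abbrev Disc (e : V) := {b : V // height e b = 0 ∧ ‖b‖ ≤ 1}

/-- The cylinder factor by which the central projection from above expands a point. -/
def expansion (r t : ℝ) : ℝ := (max r (1 - t / 2))⁻¹

lemma half_le_max (r : ℝ) {t : ℝ} (ht : t ∈ Icc (0 : ℝ) 1) : 1 / 2 ≤ max r (1 - t / 2) :=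
  le_max_of_le_right (by linarith [ht.2])

lemma one_le_expansion {e : V} (b : Disc e) (t : I) : 1 ≤ expansion ‖(b : V)‖ t := by
  have := half_le_max ‖(b : V)‖ t.2
  rw [expansion, one_le_inv₀ (by linarith)]
  exact max_le b.2.2 (by linarith [t.2.1])

lemma expansion_le_two (r : ℝ) (t : I) : expansion r t ≤ 2 := by
  have := half_le_max r t.2
  rw [expansion, inv_le_comm₀ (by linarith) two_pos]
  linarith

lemma expansion_mul_self_le (r : ℝ) (t : I) : expansion r t * r ≤ 1 := by
  have := half_le_max r t.2
  rw [expansion, inv_mul_le_iff₀ (by linarith), mul_one]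
  exact le_max_left _ _

lemma expansion_mul_le (r : ℝ) (t : I) : expansion r t * (2 - t) ≤ 2 := by
  have := half_le_max r t.2
  rw [expansion, inv_mul_le_iff₀ (by linarith)]
  linarith [le_max_right r (1 - (t : ℝ) / 2)]

lemma continuous_expansion {e : V} : Continuous fun z : Disc e × I ↦ expansion ‖(z.1 : V)‖ z.2 := by
  unfold expansion
  refine Continuous.inv₀ (by fun_prop) fun z ↦ ?_
  have := half_le_max ‖(z.1 : V)‖ z.2.2
  linarith

/-- The bottom and the side of the cylinder over a disc. -/
def box (e : V) : Set (Disc e × I) := {z | ‖(z.1 : V)‖ = 1 ∨ z.2 = 0}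

/-- The deformation of the cylinder onto its bottom and side. -/
def cylinderDeformation (e : V) : C((Disc e × I) × I, Disc e × I) where
  toFun q :=
    -- Points move on rays from the apex at height 2 on the axis. The full expansion factor reaches
    -- the bottom or the side; at time `expansion - 1` the factor is 1 and the point is back in
    -- place.
    let κ := max 1 (expansion ‖(q.1.1 : V)‖ q.1.2 - q.2)
    have h1 : 1 ≤ κ := le_max_left _ _
    have h2 : κ ≤ expansion ‖(q.1.1 : V)‖ q.1.2 :=
      max_le (one_le_expansion _ _) (by linarith [q.2.2.1])
    (⟨κ • (q.1.1 : V), by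
        have h3 : height e (κ • (q.1.1 : V)) = κ * height e (q.1.1 : V) := by
          simp [height, inner_smul_left]
        rw [h3, q.1.1.2.1, mul_zero], by
        rw [norm_smul, Real.norm_of_nonneg (by linarith)]
        exact (mul_le_mul_of_nonneg_right h2 (norm_nonneg _)).trans (expansion_mul_self_le _ _)⟩,
      ⟨2 - κ * (2 - q.1.2), by
        have h3 : 0 ≤ 2 - (q.1.2 : ℝ) := by linarith [q.1.2.2.2]
        have := (mul_le_mul_of_nonneg_right h2 h3).trans (expansion_mul_le ‖(q.1.1 : V)‖ _)
        linarith, by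
        have h3 : 1 ≤ 2 - (q.1.2 : ℝ) := by linarith [q.1.2.2.2]
        nlinarith⟩)
  continuous_toFun := by
    have h : Continuous fun q : (Disc e × I) × I ↦ expansion ‖(q.1.1 : V)‖ q.1.2 :=
      continuous_expansion.comp continuous_fst
    refine Continuous.prodMk (Continuous.subtype_mk ?_ _) (Continuous.subtype_mk ?_ _)
    all_goals fun_prop

lemma HasHomotopyLifting.exists_extension_box {e : V} (h : HasHomotopyLifting p (Disc e × I))
    (H : C(Disc e × I, B)) (g : C(box e, N)) (hg : ∀ z, p (g z) = H z) :
    ∃ G : C(Disc e × I, N), (∀ z, p (G z) = H z) ∧ ∀ z : box e, G z = g z := by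
  refine h.exists_extension (box e)
    ⟨fun z ↦ ⟨expansion ‖(z.1 : V)‖ z.2 - 1, by linarith [one_le_expansion z.1 z.2],
      by linarith [expansion_le_two ‖(z.1 : V)‖ z.2]⟩, ?_⟩ (cylinderDeformation e) ?_ ?_ ?_ H g hg
  · have := continuous_expansion (e := e)
    fun_prop
  · rintro ⟨b, t⟩
    have h0 := half_le_max ‖(b : V)‖ t.2
    have h1 := one_le_expansion b t
    have h2 : max 1 (expansion ‖(b : V)‖ t - ((0 : I) : ℝ)) = expansion ‖(b : V)‖ t := by
      simp [h1]
    rcases le_total (1 - (t : ℝ) / 2) ‖(b : V)‖ with h | h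
    · left
      change ‖max 1 (expansion ‖(b : V)‖ t - ((0 : I) : ℝ)) • (b : V)‖ = 1
      rw [h2, norm_smul, Real.norm_of_nonneg (by linarith), expansion, max_eq_left h]
      rw [max_eq_left h] at h0
      exact inv_mul_cancel₀ (by linarith)
    · right
      ext1
      change 2 - max 1 (expansion ‖(b : V)‖ t - ((0 : I) : ℝ)) * (2 - (t : ℝ)) = 0
      rw [h2, expansion, max_eq_right h]
      rw [max_eq_right h] at h0
      have : 1 - (t : ℝ) / 2 ≠ 0 := by linarith
      rw [show 2 - (t : ℝ) = (1 - t / 2) * 2 by ring, inv_mul_cancel_left₀ this, sub_self]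
  · rintro ⟨b, t⟩
    have h2 : max 1 (expansion ‖(b : V)‖ t - (expansion ‖(b : V)‖ t - 1)) = 1 := by simp
    refine Prod.ext (Subtype.ext ?_) (Subtype.ext ?_)
    · change max 1 (expansion ‖(b : V)‖ t - (expansion ‖(b : V)‖ t - 1)) • (b : V) = b
      rw [h2, one_smul]
    · change 2 - max 1 (expansion ‖(b : V)‖ t - (expansion ‖(b : V)‖ t - 1)) * (2 - (t : ℝ)) = t
      rw [h2]; ring
  · rintro ⟨b, t⟩ hz
    ext1
    change expansion ‖(b : V)‖ t - 1 = 0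
    rcases hz with hz | hz
    · simp only at hz
      rw [hz, expansion, max_eq_left (by linarith [t.2.1]), inv_one, sub_self]
    · simp only at hz
      rw [hz, expansion, max_eq_right (by simpa using b.2.2)]
      simp

/-- The retraction of the ambient space onto a disc. -/
def discRetraction {e : V} (he : ‖e‖ = 1) : C(V, Disc e) where
  toFun y := ⟨(max 1 ‖y - height e y • e‖)⁻¹ • (y - height e y • e), by
    simp [height, inner_smul_left, inner_sub_left, he], by
    have h1 : 0 < max 1 ‖y - height e y • e‖ := lt_max_of_lt_left one_pos
    rw [norm_smul, norm_inv, Real.norm_of_nonneg h1.le, inv_mul_le_iff₀ h1, mul_one]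
    exact le_max_right _ _⟩
  continuous_toFun := by
    have := continuous_height e
    refine Continuous.subtype_mk (Continuous.smul (Continuous.inv₀ (by fun_prop) fun y ↦ ?_)
      (by fun_prop)) _
    exact (lt_max_of_lt_left one_pos).ne'

lemma discRetraction_coe {e : V} (he : ‖e‖ = 1) (b : Disc e) :
    discRetraction he (b : V) = b := by
  ext1
  simp [discRetraction, b.2.1, max_eq_left b.2.2]

end Disc

/-- The cylinder is a retract of a cube: the disc sits in `[-1, 1]^k`, rescaled to `[0, 1]^k`, and
`discRetraction` maps everything back. -/
lemma IsSerreFibration.hasHomotopyLifting_cylinder (hp : IsSerreFibration p) {k : ℕ}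
    {e : EuclideanSpace ℝ (Fin k)} (he : ‖e‖ = 1) : HasHomotopyLifting p (Disc e × I) := by
  have hcube : HasHomotopyLifting p (Fin (k + 1) → I) := hp (k + 1)
  refine hcube.of_retract
    ⟨fun z ↦ Fin.cons z.2 fun i ↦ projIcc 0 1 zero_le_one (((z.1 : EuclideanSpace ℝ (Fin k)) i + 1) / 2),
      ?_⟩
    ⟨fun c ↦ (discRetraction he (WithLp.toLp 2 fun i ↦ 2 * (c i.succ : ℝ) - 1), c 0), ?_⟩ ?_
  · refine continuous_pi fun i ↦ ?_
    refine Fin.cases ?_ (fun i ↦ ?_) i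
    · exact continuous_snd
    · simp only [Fin.cons_succ]
      exact continuous_projIcc.comp (by fun_prop)
  · fun_prop
  · rintro ⟨b, t⟩
    refine Prod.ext ?_ rfl
    simp only [ContinuousMap.coe_mk, Fin.cons_succ]
    convert discRetraction_coe he b using 2
    ext i
    have h1 : |(b : EuclideanSpace ℝ (Fin k)) i| ≤ 1 :=
      (PiLp.norm_apply_le (b : EuclideanSpace ℝ (Fin k)) i).trans b.2.2
    obtain ⟨h2, h3⟩ := abs_le.mp h1
    simp only
    rw [coe_projIcc, min_eq_right (by linarith), max_eq_right (by linarith)]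
    ring

end Fibration

/-! ### Fibrations with a section -/

noncomputable section FibrationWithSection

open Set Filter Topology Metric

section HemisphereChart

variable {V : Type*} [NormedAddCommGroup V] [InnerProductSpace ℝ V]

/-- The inverse of the vertical projection of the upper hemisphere to a disc. -/
def discToSphere (e : sphere (0 : V) 1) : C(Disc (e : V), sphere (0 : V) 1) where
  toFun b := ⟨(b : V) + √(1 - ‖(b : V)‖ ^ 2) • (e : V), by
    have h1 : inner ℝ (b : V) (e : V) = 0 := b.2.1
    have h2 : 0 ≤ 1 - ‖(b : V)‖ ^ 2 := by nlinarith [b.2.2, norm_nonneg (b : V)]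
    have h3 : ‖(b : V) + √(1 - ‖(b : V)‖ ^ 2) • (e : V)‖ ^ 2 = 1 := by
      rw [norm_add_sq_real, inner_smul_right, h1, norm_smul, norm_eq_of_mem_sphere e, mul_one,
        Real.norm_of_nonneg (Real.sqrt_nonneg _), Real.sq_sqrt h2]
      ring
    rw [mem_sphere_zero_iff_norm]
    exact (pow_eq_one_iff_of_nonneg (norm_nonneg _) two_ne_zero).mp h3⟩

lemma ht_discToSphere (e : sphere (0 : V) 1) (b : Disc (e : V)) :
    ht e (discToSphere e b) = √(1 - ‖(b : V)‖ ^ 2) := by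
  have h1 : inner ℝ (b : V) (e : V) = 0 := b.2.1
  change inner ℝ ((b : V) + √(1 - ‖(b : V)‖ ^ 2) • (e : V)) (e : V) = _
  simp [inner_add_left, inner_smul_left, h1]

lemma norm_sq_sub_height (e x : sphere (0 : V) 1) :
    ‖(x : V) - ht e x • (e : V)‖ ^ 2 = 1 - ht e x ^ 2 := by
  have := norm_sq_axial (norm_eq_of_mem_sphere e) 0 1 (norm_eq_of_mem_sphere x)
  simpa [axial] using this

/-- The vertical projection of the sphere to a disc. -/
def sphereToDisc (e : sphere (0 : V) 1) : C(sphere (0 : V) 1, Disc (e : V)) where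
  toFun x := ⟨(x : V) - ht e x • (e : V), by
      simp [height, inner_sub_left, inner_smul_left], by
      have := norm_sq_sub_height e x
      nlinarith [norm_nonneg ((x : V) - ht e x • (e : V)), sq_nonneg (ht e x)]⟩
  continuous_toFun := by
    have := continuous_ht e
    fun_prop

lemma discToSphere_sphereToDisc {e x : sphere (0 : V) 1} (h : 0 ≤ ht e x) :
    discToSphere e (sphereToDisc e x) = x := by
  ext1
  change (x : V) - ht e x • (e : V) + √(1 - ‖(x : V) - ht e x • (e : V)‖ ^ 2) • (e : V) = x
  rw [norm_sq_sub_height, sub_sub_cancel, Real.sqrt_sq h, sub_add_cancel]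

lemma norm_sphereToDisc_eq_one_iff {e x : sphere (0 : V) 1} :
    ‖(sphereToDisc e x : V)‖ = 1 ↔ ht e x = 0 := by
  change ‖(x : V) - ht e x • (e : V)‖ = 1 ↔ _
  rw [← pow_eq_one_iff_of_nonneg (norm_nonneg _) two_ne_zero, norm_sq_sub_height]
  simp

end HemisphereChart

variable {N B : Type*} [TopologicalSpace N] [TopologicalSpace B] {p : C(N, B)} {s : C(B, N)}

/-- Up to homotopy, a map from a sphere to a fibration with section splits into a part in a fibre
and a part in the image of the section. -/
lemma exists_homotopic_split {k : ℕ} {e : sphere (0 : EuclideanSpace ℝ (Fin k)) 1}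
    (hp : IsSerreFibration p) (hs : ∀ b, p (s b) = b)
    {f : C(sphere (0 : EuclideanSpace ℝ (Fin k)) 1, N)} (hf : s (p (f (-e))) = f (-e)) :
    ∃ f' : C(sphere (0 : EuclideanSpace ℝ (Fin k)) 1, N), f.Homotopic f' ∧
      (∀ x, 0 ≤ ht e x → p (f' x) = p (f e)) ∧ (∀ x, ht e x ≤ 0 → f' x ∈ range s) ∧
      ∀ x, ht e x = 0 → f' x = s (p (f e)) := by
  have hfib := hp.hasHomotopyLifting_cylinder (norm_eq_of_mem_sphere e)
  let u : C(sphere (0 : EuclideanSpace ℝ (Fin k)) 1, sphere (0 : EuclideanSpace ℝ (Fin k)) 1) :=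
    (collapse e).curry 1
  have hu : ∀ x, ht e x ≤ 0 → u x = -e := fun x hx ↦ collapse_one_of_nonpos hx
  have hue : u e = e := collapseFamily.map_pole (by norm_num [collapseFamily])
  let φ : C(sphere (0 : EuclideanSpace ℝ (Fin k)) 1, N) := s.comp (p.comp f)
  have h_sec : φ (-e) = f (-e) := hf
  have hps : ∀ x, p (φ x) = p (f x) := fun x ↦ hs _
  -- In the base, the image of the upper hemisphere is contracted to `p (f e)`.
  let H : C(Disc (e : EuclideanSpace ℝ (Fin k)) × I, B) :=
    ⟨fun z ↦ p (f (u (collapse (-e) (z.2, discToSphere e z.1)))), by fun_prop⟩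
  have hg : ∀ z : box (e : EuclideanSpace ℝ (Fin k)), 1 - ‖(z.1.1 : EuclideanSpace ℝ (Fin k))‖ = z.1.2 →
      ht e (discToSphere e z.1.1) = 0 ∧ z.1.2 = 0 := by
    rintro ⟨⟨b, t⟩, hz⟩ h
    simp only at h ⊢
    have h0 : ‖(b : EuclideanSpace ℝ (Fin k))‖ = 1 ∧ t = 0 := by
      rcases hz with hz | hz <;> simp only at hz
      · refine ⟨hz, Subtype.ext ?_⟩
        rw [← h, hz]; simp
      · refine ⟨?_, hz⟩
        rw [hz, Icc.coe_zero] at h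
        linarith
    refine ⟨?_, h0.2⟩
    rw [ht_discToSphere, h0.1]; simp
  -- On the box the condition holds exactly on the side: there the lift is prescribed through the
  -- section, while on the rest of the bottom it is `f ∘ u`. They agree on the rim, where `f ∘ u`
  -- takes the value `f (-e)` in the section.
  let g : C(box (e : EuclideanSpace ℝ (Fin k)), N) :=
    ⟨fun z ↦ if 1 - ‖(z.1.1 : EuclideanSpace ℝ (Fin k))‖ ≤ z.1.2 then
      φ (u (collapse (-e) (z.1.2, discToSphere e z.1.1))) else f (u (discToSphere e z.1.1)), by
      refine Continuous.if_le (by fun_prop) (by fun_prop) (by fun_prop) (by fun_prop) fun z hz ↦ ?_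
      obtain ⟨h1, h2⟩ := hg z hz
      rw [h2, collapse_zero, hu _ h1.le, h_sec]⟩
  have hpg : ∀ z, p (g z) = H z := by
    rintro ⟨⟨b, t⟩, hz⟩
    simp only [g, H, ContinuousMap.coe_mk]
    split_ifs with h
    · rw [hps]
    · rcases hz with hz | hz <;> simp only at hz h
      · rw [hz, sub_self] at h
        exact absurd t.2.1 h
      · rw [hz, collapse_zero]
  obtain ⟨G, hG, hGg⟩ := hfib.exists_extension_box H g hpg
  have hGt : ∀ x t, ht e x = 0 →
      G (sphereToDisc e x, t) = φ (u (collapse (-e) (t, x))) := by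
    intro x t hx
    have h1 := norm_sphereToDisc_eq_one_iff.mpr hx
    have h2 := hGg ⟨(sphereToDisc e x, t), Or.inl h1⟩
    simp only [g, ContinuousMap.coe_mk, h1, sub_self] at h2
    rw [if_pos t.2.1, discToSphere_sphereToDisc hx.ge] at h2
    exact h2
  have hG0 : ∀ x, 0 ≤ ht e x → G (sphereToDisc e x, 0) = f (u x) := by
    intro x hx
    have h2 := hGg ⟨(sphereToDisc e x, 0), Or.inr rfl⟩
    simp only [g, ContinuousMap.coe_mk, discToSphere_sphereToDisc hx, collapse_zero] at h2
    rw [h2]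
    split_ifs with h
    · have h3 : ‖(sphereToDisc e x : EuclideanSpace ℝ (Fin k))‖ = 1 :=
        le_antisymm (sphereToDisc e x).2.2 (by simpa using h)
      rw [hu _ (norm_sphereToDisc_eq_one_iff.mp h3).le, h_sec]
    · rfl
  let T : C(I × sphere (0 : EuclideanSpace ℝ (Fin k)) 1, N) :=
    ⟨fun z ↦ if 0 ≤ ht e z.2 then G (sphereToDisc e z.2, z.1)
      else φ (u (collapse (-e) z)), by
      have := continuous_ht e
      exact Continuous.if_le (by fun_prop) (by fun_prop) continuous_const
        (this.comp continuous_snd) fun z hz ↦ hGt _ _ hz.symm⟩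
  have hT : ∀ t x, ht e x ≤ 0 → T (t, x) = φ (u (collapse (-e) (t, x))) := by
    intro t x hx
    simp only [T, ContinuousMap.coe_mk]
    split_ifs with h
    · exact hGt _ _ (le_antisymm hx h)
    · rfl
  refine ⟨T.curry 1, (homotopic_comp_collapse e f).trans
    ⟨{ toContinuousMap := T
       map_zero_left := fun x ↦ ?_
       map_one_left := fun x ↦ rfl }⟩, fun x hx ↦ ?_, fun x hx ↦ ?_, fun x hx ↦ ?_⟩
  · change T (0, x) = f (u x)
    rcases le_total 0 (ht e x) with h | h
    · exact (if_pos h).trans (hG0 x h)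
    · rw [hT _ _ h, collapse_zero, hu _ h, h_sec]
  · change p (T (1, x)) = _
    have h1 : T (1, x) = G (sphereToDisc e x, 1) := if_pos hx
    rw [h1, hG]
    simp only [H, ContinuousMap.coe_mk]
    rw [discToSphere_sphereToDisc hx, collapse_neg_one_of_nonneg hx, hue]
  · change T (1, x) ∈ _
    rw [hT _ _ hx]
    exact ⟨_, rfl⟩
  · change T (1, x) = _
    rw [hT _ _ hx.le, collapse_neg_one_of_nonneg hx.ge, hue]
    rfl

/-- Maps from spheres to a fibration with section whose base and some fibre have at least two
points can be made disjoint from a nullhomotopic map. -/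
theorem avoidable_of_serreFibration [PathConnectedSpace N]
    (hN : ∀ y : N, IsPathConnected ({y}ᶜ : Set N)) {k : ℕ}
    (e : sphere (0 : EuclideanSpace ℝ (Fin k)) 1)
    (hp : IsSerreFibration p) (hs : ∀ b, p (s b) = b) [Nontrivial B] {b₁ : B}
    (hb : (p ⁻¹' {b₁}).Nontrivial) (f : C(sphere (0 : EuclideanSpace ℝ (Fin k)) 1, N)) :
    Avoidable e f := by
  let γ₀ : Path (f (-e)) (s b₁) := PathConnectedSpace.somePath _ _
  -- Dragging the value at `-e` to `s b₁` puts it on the section, as the splitting requires.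
  let f₀ := withTail e f ⟨γ₀.extend, γ₀.continuous_extend⟩ γ₀.extend_zero
  have hf₀ : f₀ (-e) = s b₁ := by
    refine withTail_antipole.trans ?_
    exact γ₀.extend_of_one_le (by norm_num)
  obtain ⟨f', hff', h1, h2, h3⟩ := exists_homotopic_split (e := e) (f := f₀) hp hs (by
    rw [hf₀, hs])
  set b₀ := p (f₀ e)
  obtain ⟨b', hb'⟩ := exists_ne b₀
  obtain ⟨y, hy, hys⟩ := hb.exists_ne (s b₁)
  have hyr : y ∉ range s := by
    rintro ⟨b, rfl⟩
    rw [mem_preimage, hs, mem_singleton_iff] at hy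
    exact hys (congrArg s hy)
  have hsb : s b' ≠ s b₀ := fun h ↦ hb' (by rw [← hs b', h, hs])
  obtain ⟨γ, hγ⟩ := (hN (s b₀)).joinedIn y (fun h ↦ hyr ⟨b₀, h.symm⟩) (s b') hsb
  -- The curve is `s b'` on heights at least 1/2, where the map stays over `b₀`, and `y` on heights
  -- at most -1/2, where the map stays in the section. In between the map is constantly `s b₀`,
  -- which `γ` avoids.
  refine ⟨f'.comp ((collar e).curry 1),
    (homotopic_withTail.trans hff').trans (homotopic_comp_collar e f'),
    ⟨fun a ↦ γ.extend (a + 1 / 2), γ.continuous_extend.comp (by fun_prop)⟩, fun x hx ↦ ?_⟩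
  change f' (collar e (1, x)) = γ.extend (ht e x + 1 / 2) at hx
  rcases le_total (1 / 2) (ht e x) with h | h
  · rw [γ.extend_of_one_le (by linarith)] at hx
    have := h1 _ (ht_collar_nonneg (x := x) (by linarith))
    rw [hx, hs] at this
    exact hb' this
  rcases le_total (ht e x) (-(1 / 2)) with h' | h'
  · rw [γ.extend_of_le_zero (by linarith)] at hx
    exact hyr (hx ▸ h2 _ (ht_collar_nonpos (x := x) (by linarith)))
  · rw [h3 _ (ht_collar_eq_zero (abs_le.mpr ⟨h', h⟩)),
      γ.extend_apply ⟨by linarith, by linarith⟩] at hx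
    exact hγ _ hx.symm

end FibrationWithSection

/-! ### The four cases -/

open Metric in
theorem proposition1p3 (m n : ℕ) (hm : 2 ≤ m) (hn : 2 ≤ n)
    (N : Type*) [TopologicalSpace N] [T2Space N] [SecondCountableTopology N] [ConnectedSpace N]
    [ChartedSpace (EuclideanSpace ℝ (Fin n)) N] [IsManifold (𝓡 n) ∞ N]
    (h : m < n ∨
      NoncompactSpace N ∨
      (∃ y : N, Infinite (FundamentalGroup N y)) ∨
      (∃ (B : Type*) (_ : TopologicalSpace B) (p : C(N, B)) (s : C(B, N)),
        IsSerreFibration p ∧ (∀ b, p (s b) = b) ∧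
        0 < smallInductiveDimension B ∧ ∃ b : B, 0 < smallInductiveDimension (p ⁻¹' {b}))) :
    ∀ f₁ f₂ : C(Metric.sphere (0 : EuclideanSpace ℝ (Fin (m + 1))) 1, N),
      IsLoosePair f₁ f₂ := by
  intro f₁ f₂
  have hN : LocallyModeledOn (EuclideanSpace ℝ (Fin n)) N := .of_openPartialHomeomorph fun y ↦
    ⟨chartAt (EuclideanSpace ℝ (Fin n)) y, mem_chart_source _ y⟩
  have hE : 1 < Module.rank ℝ (EuclideanSpace ℝ (Fin n)) :=
    Module.one_lt_rank_of_one_lt_finrank (by simpa using (show 1 < n from hn))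
  have : Nontrivial (EuclideanSpace ℝ (Fin n)) := rank_pos_iff_nontrivial.mp (zero_lt_one.trans hE)
  have : LocallyPathConnectedSpace N :=
    ChartedSpace.locallyPathConnectedSpace (EuclideanSpace ℝ (Fin n)) N
  have : PathConnectedSpace N := pathConnectedSpace_iff_connectedSpace.mpr inferInstance
  have hdense : ∀ y : N, Dense ({y}ᶜ : Set N) := fun y ↦
    (locallySubsingleton_singleton y).dense_compl hN
  have hcompl : ∀ y : N, IsPathConnected ({y}ᶜ : Set N) := fun y ↦
    isOpen_compl_singleton.isConnected_iff_isPathConnected.mp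
      ⟨(hdense y).nonempty, (locallySubsingleton_singleton y).isPreconnected_compl hN hE⟩
  have h3 : ∀ a b : N, ∃ z, z ≠ a ∧ z ≠ b := by
    intro a b
    obtain ⟨z, hz, hz'⟩ := (hdense a).inter_open_nonempty _ (isOpen_compl_singleton (x := b))
      (hdense b).nonempty
    exact ⟨z, hz', hz⟩
  have hfin : Module.finrank ℝ (EuclideanSpace ℝ (Fin (m + 1))) = m + 1 := by simp
  let e : sphere (0 : EuclideanSpace ℝ (Fin (m + 1))) 1 := ⟨EuclideanSpace.single 0 1, by simp⟩
  have key : ∀ (e : sphere (0 : EuclideanSpace ℝ (Fin (m + 1))) 1)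
      (f : C(sphere (0 : EuclideanSpace ℝ (Fin (m + 1))) 1, N)), Avoidable e f := by
    intro e f
    rcases h with h | h | ⟨y, h⟩ | ⟨B, _, p, s, hp, hs, hB, b, hb⟩
    · obtain ⟨f', hf, y, hy⟩ := exists_homotopic_notMem_of_lt hN hfin (by simpa using h) e f
      exact .of_homotopic_of_notMem hf hy
    · obtain ⟨y, hy⟩ := Set.nonempty_compl.mpr (isCompact_range f.continuous).ne_univ
      exact .of_homotopic_of_notMem (.refl f) fun x hx ↦ hy ⟨x, hx⟩
    · obtain ⟨f', hf, y, hy⟩ := exists_homotopic_notMem_of_infinite hN hE y hfin hm e f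
      exact .of_homotopic_of_notMem hf hy
    · have := nontrivial_of_smallInductiveDimension_pos hB
      have := nontrivial_of_smallInductiveDimension_pos hb
      exact avoidable_of_serreFibration hcompl e hp hs (Set.nontrivial_coe_sort.mp this) f
  exact isLoosePair_of_avoidable hcompl h3 (key e f₁) (key (-e) f₂)
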